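/- **Setting (online trading, known valuations, single-minded agents).** A retailer stores $n$ item types with positive integer inventory caps $w_1,\dots,w_n$ and starts with a full inventory. Agents arrive online. A customer offers to pay $v^t\ge 0$ for a bundle with $a_i\in\mathbb Z_{\ge0}$ units of each type $i$; a supplier offers such a bundle at price $v^t\ge0$. On each arrival a deterministic algorithm decides, from the arrivals so far, whether to trade; its inventory is integral and stays in $[0,w_i]$ for each type $i$, and items may be discarded for free at any time. Its profit is the revenue from sales minus the cost of purchases. A randomized algorithm is a random deterministic algorithm, evaluated by its expected profit on each fixed instance. For an instance, $d$ is the largest number of items in a customer's bundle, and customer values are scaled so that the smallest nonzero one is $1$ and the largest is $v$. Algorithms may depend on $n,w,d,v,\varepsilon$. The benchmark $\mathrm{OPT}_\varepsilon$ is the optimal offline fractional profit with the same caps, where an offline solution trades a fraction in $[0,1]$ of each bundle, may hold fractional inventory, has free disposal, and pays suppliers $(1+\varepsilon)$ times their values. An algorithm is $\rho$-competitive ($\rho>0$) on a class of instances if for some constant $C$, $\mathrm{OPT}\le\rho\cdot\mathrm{ALG}+C$ on every instance in the class; its ratio is unbounded if it is $\rho$-competitive for no $\rho>0$. **Theorem.**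 (i) There is an absolute constant $c>0$ such that for all $\varepsilon\in(0,1]$, all $n$, all caps $w$, every item type $i$, and all $d\ge1$, $v\ge1$: every deterministic or randomized algorithm that is $\rho$-competitive against $\mathrm{OPT}_\varepsilon$ on the instances with parameters $d,v$ in which every bundle has at most $d$ items, all of type $i$, satisfies $\rho\ge\frac c\varepsilon\log v$, and, if $v\ge2$, also $\rho\ge\frac c\varepsilon\log(dv)$. Without augmentation ($\varepsilon=0$), for all $n$, $w$, $i$, $d\ge 1$, $v\ge 1$, the ratio of every deterministic or randomized algorithm on these instances is unbounded. (ii) Consider instances in which every bundle contains either $0$ or exactly $m\ge1$ units of each type, has at most $d=mk$ items (so at most $k$ distinct types), and whose parameters are $d,v$ (so $k=d$ if $m=1$). Let $\varepsilon\in(0,1]$, $k\geq 1$, $v\ge1$. On these instances the ratio of every deterministic algorithm is unbounded, both against $\mathrm{OPT}_\varepsilon$ and against the optimal integral offline solution (also paying $(1+\varepsilon)$ times the supplier values) that can hold only $m$ units of each type (a single item of each type if $m=1$), in each of the following cases: - $k\le n$ and some type $i$ has $w_i<\frac{1}{4\varepsilon}\log v\cdot m$; - $v\ge2$ and at least $k$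 types $i$ have $w_i<\frac1{8\varepsilon}\log k\cdot m$; - $m\le k$, ($v\ge2$ or $d=1$), and at least $k$ types $i$ have $w_i<\frac c\varepsilon\log(dv)\cdot m$, where $c>0$ is an absolute constant. -/

import Mathlib

open MeasureTheory

namespace OnlineTrading

/-- A single-minded agent for `n` item types: a customer who wants to buy `bundle` (`bundle i` units
of type `i`) for `value`, or a supplier who offers `bundle` for `value`. -/
structure Agent (n : ℕ) where
  isCustomer : Bool
  bundle : Fin n → ℕ
  value : ℝ
  value_nonneg : 0 ≤ value

/-- The number of items in the bundle of an agent. -/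
def Agent.size {n : ℕ} (a : Agent n) : ℕ := ∑ i, a.bundle i

/-- An instance: the agents in their order of arrival. -/
abbrev Instance (n : ℕ) := List (Agent n)

/-- A deterministic online algorithm with inventory caps `w`. It starts with a full inventory.
After the arrivals `h` it sees the next agent `a` and trades with it (`accept h a = true`) or not;
`inv h i` is the integral number of units of type `i` held after the arrivals `h`.
The inequalities express that any items may be discarded at any time, at no cost. -/
structure OnlineAlg {n : ℕ} (w : Fin n → ℕ) where
  accept : Instance n → Agent n → Bool
  inv : Instance n → Fin n → ℕ
  inv_nil : inv [] = w
  inv_le : ∀ h i, inv h i ≤ w i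
  inv_reject : ∀ h a, accept h a = false → ∀ i, inv (h ++ [a]) i ≤ inv h i
  inv_sell : ∀ h a, accept h a = true → a.isCustomer = true →
    ∀ i, inv (h ++ [a]) i + a.bundle i ≤ inv h i
  inv_buy : ∀ h a, accept h a = true → a.isCustomer = false →
    ∀ i, inv (h ++ [a]) i ≤ inv h i + a.bundle i

namespace OnlineAlg

variable {n : ℕ} {w : Fin n → ℕ}

/-- The money gained when `a` arrives after `h` (known valuations: the price is the value). -/
noncomputable def gain (A : OnlineAlg w) (h : Instance n) (a : Agent n) : ℝ :=
  if A.accept h a = true then (if a.isCustomer = true then a.value else -a.value) else 0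

/-- The profit made on the arrivals `l`, after the arrivals `h`. -/
noncomputable def profitFrom (A : OnlineAlg w) : Instance n → Instance n → ℝ
  | _, [] => 0
  | h, a :: l => A.gain h a + A.profitFrom (h ++ [a]) l

/-- The profit on an instance. -/
noncomputable def profit (A : OnlineAlg w) (σ : Instance n) : ℝ := A.profitFrom [] σ

end OnlineAlg

/-- A randomized online algorithm (against an oblivious adversary): a random deterministic one. -/
structure RandomizedAlg {n : ℕ} (w : Fin n → ℕ) (Ω : Type*) [MeasurableSpace Ω] where
  alg : Ω → OnlineAlg w
  measurable_accept : ∀ h a, Measurable fun ω => (alg ω).accept h a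

/-- The expected profit of a randomized algorithm. -/
noncomputable def RandomizedAlg.expectedProfit {n : ℕ} {w : Fin n → ℕ} {Ω : Type*}
    [MeasurableSpace Ω] (R : RandomizedAlg w Ω) (μ : Measure Ω) (σ : Instance n) : ℝ :=
  ∫ ω, (R.alg ω).profit σ ∂μ

/-- Feasible fractional offline solutions with caps `cap`: `x t` is the fraction of the `t`-th
bundle that is traded, `r t i` the amount of type `i` held before the `t`-th arrival. -/
structure IsFeasible {n : ℕ} (cap : Fin n → ℕ) (σ : Instance n) (x : ℕ → ℝ)
    (r : ℕ → Fin n → ℝ) : Prop where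
  x_nonneg : ∀ t, 0 ≤ x t
  x_le_one : ∀ t, x t ≤ 1
  r_nonneg : ∀ t i, 0 ≤ r t i
  r_le : ∀ t i, r t i ≤ cap i
  sell : ∀ t : Fin σ.length, σ[t].isCustomer = true →
    ∀ i, r (t + 1) i ≤ r t i - σ[t].bundle i * x t
  buy : ∀ t : Fin σ.length, σ[t].isCustomer = false →
    ∀ i, r (t + 1) i ≤ r t i + σ[t].bundle i * x t

/-- The profit of an offline solution that pays `1 + ε` times the values of the suppliers. -/
noncomputable def offlineProfit {n : ℕ} (ε : ℝ) (σ : Instance n) (x : ℕ → ℝ) : ℝ :=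
  ∑ t : Fin σ.length,
    x t * (if σ[t].isCustomer = true then σ[t].value else -((1 + ε) * σ[t].value))

/-- The optimal fractional offline profit. -/
noncomputable def fracOpt {n : ℕ} (ε : ℝ) (cap : Fin n → ℕ) (σ : Instance n) : ℝ :=
  sSup {p | ∃ x r, IsFeasible cap σ x r ∧ p = offlineProfit ε σ x}

/-- The optimal integral offline profit: whole bundles are traded and whole units are held. -/
noncomputable def intOpt {n : ℕ} (ε : ℝ) (cap : Fin n → ℕ) (σ : Instance n) : ℝ :=
  sSup {p | ∃ x r, IsFeasible cap σ x r ∧ (∀ t, x t = 0 ∨ x t = 1) ∧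
    (∀ t i, ∃ q : ℕ, r t i = q) ∧ p = offlineProfit ε σ x}

/-- `d` is the largest size of a bundle of a customer, `1` the smallest nonzero value of a bundle
to a customer, and `v` the largest one. -/
structure HasParams {n : ℕ} (σ : Instance n) (d : ℕ) (v : ℝ) : Prop where
  size : IsGreatest {k | ∃ a ∈ σ, a.isCustomer = true ∧ a.size = k} d
  min_value : IsLeast {y | ∃ a ∈ σ, a.isCustomer = true ∧ a.value = y ∧ y ≠ 0} 1
  max_value : IsGreatest {y | ∃ a ∈ σ, a.isCustomer = true ∧ a.value = y} v

/-- Instances with parameters `d`, `v` in which every bundle has at most `d` items, all of them of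
type `i`. -/
def singleTypeInstances {n : ℕ} (i : Fin n) (d : ℕ) (v : ℝ) : Set (Instance n) :=
  {σ | HasParams σ d v ∧ ∀ a ∈ σ, a.size ≤ d ∧ ∀ j, j ≠ i → a.bundle j = 0}

/-- Instances with parameters `d`, `v` in which every bundle has at most `d` items, and `0` or `m`
of each type. -/
def multiplicityInstances (n m d : ℕ) (v : ℝ) : Set (Instance n) :=
  {σ | HasParams σ d v ∧ ∀ a ∈ σ, a.size ≤ d ∧ ∀ j, a.bundle j = 0 ∨ a.bundle j = m}

/-- An algorithm with profit `alg` is `ρ`-competitive against the benchmark `opt` on the instances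
in `K`, up to an additive constant that does not depend on the instance. -/
def IsCompetitive {n : ℕ} (K : Set (Instance n)) (opt alg : Instance n → ℝ) (ρ : ℝ) : Prop :=
  ∃ C : ℝ, ∀ σ ∈ K, opt σ ≤ ρ * alg σ + C

/-- No finite `ρ` is a competitive ratio. -/
def HasUnboundedRatio {n : ℕ} (K : Set (Instance n)) (opt alg : Instance n → ℝ) : Prop :=
  ∀ ρ : ℝ, 0 < ρ → ¬ IsCompetitive K opt alg ρ

/-! The suprema and the integral above are not junk values. -/

theorem isFeasible_zero {n : ℕ} (cap : Fin n → ℕ) (σ : Instance n) :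
    IsFeasible cap σ (fun _ => 0) (fun _ _ => 0) := by
  constructor <;> intros <;> simp

theorem offlineProfit_le {n : ℕ} (ε : ℝ) (cap : Fin n → ℕ) (σ : Instance n) (x : ℕ → ℝ)
    (r : ℕ → Fin n → ℝ) (h : IsFeasible cap σ x r) :
    offlineProfit ε σ x ≤
      ∑ t : Fin σ.length, |if σ[t].isCustomer = true then σ[t].value
        else -((1 + ε) * σ[t].value)| := by
  refine Finset.sum_le_sum fun t _ => ?_
  refine (le_abs_self _).trans ?_
  rw [abs_mul, abs_of_nonneg (h.x_nonneg t)]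
  exact mul_le_of_le_one_left (abs_nonneg _) (h.x_le_one t)

theorem le_fracOpt {n : ℕ} (ε : ℝ) (cap : Fin n → ℕ) (σ : Instance n) (x : ℕ → ℝ)
    (r : ℕ → Fin n → ℝ) (h : IsFeasible cap σ x r) : offlineProfit ε σ x ≤ fracOpt ε cap σ := by
  have hb : BddAbove {p | ∃ x r, IsFeasible cap σ x r ∧ p = offlineProfit ε σ x} := by
    refine ⟨∑ t : Fin σ.length, |if σ[t].isCustomer = true then σ[t].value
        else -((1 + ε) * σ[t].value)|, ?_⟩
    rintro p ⟨y, s, hy, rfl⟩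
    exact offlineProfit_le ε cap σ y s hy
  exact le_csSup hb ⟨x, r, h, rfl⟩

theorem le_intOpt {n : ℕ} (ε : ℝ) (cap : Fin n → ℕ) (σ : Instance n) (x : ℕ → ℝ)
    (r : ℕ → Fin n → ℝ) (h : IsFeasible cap σ x r) (hx : ∀ t, x t = 0 ∨ x t = 1)
    (hr : ∀ t i, ∃ q : ℕ, r t i = q) : offlineProfit ε σ x ≤ intOpt ε cap σ := by
  have hb : BddAbove {p | ∃ x r, IsFeasible cap σ x r ∧ (∀ t, x t = 0 ∨ x t = 1) ∧
      (∀ t i, ∃ q : ℕ, r t i = q) ∧ p = offlineProfit ε σ x} := by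
    refine ⟨∑ t : Fin σ.length, |if σ[t].isCustomer = true then σ[t].value
        else -((1 + ε) * σ[t].value)|, ?_⟩
    rintro p ⟨y, s, hy, _, _, rfl⟩
    exact offlineProfit_le ε cap σ y s hy
  exact le_csSup hb ⟨x, r, h, hx, hr, rfl⟩

theorem RandomizedAlg.integrable_profit {n : ℕ} {w : Fin n → ℕ} {Ω : Type*} [MeasurableSpace Ω]
    (R : RandomizedAlg w Ω) (μ : Measure Ω) [IsFiniteMeasure μ] (σ : Instance n) :
    Integrable (fun ω => (R.alg ω).profit σ) μ := by
  suffices H : ∀ (l h : Instance n), Integrable (fun ω => (R.alg ω).profitFrom h l) μ from H σ []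
  intro l
  induction l with
  | nil => intro h; simp [OnlineAlg.profitFrom]
  | cons a l ih =>
    intro h
    refine Integrable.add ?_ (ih (h ++ [a]))
    have hm : MeasurableSet {ω | (R.alg ω).accept h a = true} :=
      R.measurable_accept h a (measurableSet_singleton true)
    exact ((integrable_const (if a.isCustomer = true then a.value else -a.value)).indicator
      hm).congr (Filter.Eventually.of_forall fun ω => by
        simp [OnlineAlg.gain, Set.indicator])

end OnlineTrading

open OnlineTrading

/-!
Every algorithm is confronted with an adversary that, in each round, lets the offline optimum gain
more than `ρ` times as much as the algorithm. Money plus the value of the stock is the potential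
that bounds what the algorithm gains.

*Random adversaries (a single type).* Suppliers and customers trade at a market price that is a
martingale, apart from rare upward corrections. So money plus stock at the market price is a
supermartingale for every algorithm, up to these corrections, whereas the offline solution knows
the next price and profits from every rise that exceeds the augmentation. With augmentation
(`MarketAdversary.reflectedWalk`), the logarithm of the price is a walk on
`J ≈ log (D * v) / (2 * ε)` levels, reflected at both ends; the algorithm gains a fraction `2 * ε`
of the lowest price in each visit of the lowest level, and the offline solution gains on average
`ε * J` times the lowest price in the excursion that follows. This gives the ratio `J / 2`. The
levels cover `[1, v]` with single units and `[1 / d, v]` with bundles of up to `d` units, which need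
`2 ≤ v` because the size of a bundle is integral. Without augmentation
(`MarketAdversary.doublingGap`), prices below `1` suffice. Randomized algorithms are covered since
expectations over the algorithm and over the instance commute
(`MarketAdversary.not_isCompetitive`).

*Adaptive adversary (deterministic algorithms).* The price of a type decreases by the factor
`exp (-2 * ε)` with each block of `m` units that the algorithm holds. Small caps keep the prices of
`κ` types above `1 / κ` (with `v` as the highest price), so that some of the types have a total
price in `[1, v]`. This bundle is offered slightly below its price; if the algorithm buys it, it
loses money in view of the lower prices at the new stock, and otherwise a customer asks for the
bundle at its price, from which only the offline solution profits (`hasUnboundedRatio_intOpt`). It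
holds at most one block per type, and scaling it down by `m` makes it feasible for all positive
caps, so the fractional benchmark is covered as well (`intOpt_le_mul_fracOpt`).
-/

namespace OnlineTrading

/-! ### Profits of online algorithms -/

namespace OnlineAlg

variable {n : ℕ} {w : Fin n → ℕ}

theorem profitFrom_append (A : OnlineAlg w) (h l l' : Instance n) :
    A.profitFrom h (l ++ l') = A.profitFrom h l + A.profitFrom (h ++ l) l' := by
  induction l generalizing h with
  | nil => simp [profitFrom]
  | cons a l ih => simp [profitFrom, ih, add_assoc]

theorem profit_concat (A : OnlineAlg w) (h : Instance n) (a : Agent n) :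
    A.profit (h ++ [a]) = A.profit h + A.gain h a := by
  simp [profit, profitFrom_append, profitFrom]

theorem gain_le_value (A : OnlineAlg w) (h : Instance n) (a : Agent n) :
    A.gain h a ≤ a.value := by
  have := a.value_nonneg
  unfold gain
  split_ifs <;> linarith

end OnlineAlg

/-! ### Offline solutions built one arrival at a time -/

/-- The contribution of a fully traded bundle to an offline profit with augmentation `ε`. -/
noncomputable def Agent.offlineGain {n : ℕ} (ε : ℝ) (a : Agent n) : ℝ :=
  if a.isCustomer = true then a.value else -((1 + ε) * a.value)

/-- `OfflineRun ε cap X S σ s y`: an offline solution that starts with nothing in stock can end the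
instance `σ` with stock `s` and profit `y`, where it trades fractions in `X` of the bundles and
holds amounts in `S` of each type. Fractional solutions have `X = S = univ`, integral ones
`X = {0, 1}` and `S = range Nat.cast`. -/
inductive OfflineRun {n : ℕ} (ε : ℝ) (cap : Fin n → ℕ) (X S : Set ℝ) :
    Instance n → (Fin n → ℝ) → ℝ → Prop
  | nil : OfflineRun ε cap X S [] 0 0
  | concat {σ : Instance n} {s : Fin n → ℝ} {y : ℝ} (a : Agent n) (x : ℝ) (s' : Fin n → ℝ) :
      OfflineRun ε cap X S σ s y → x ∈ X → 0 ≤ x → x ≤ 1 →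
      (∀ i, s' i ∈ S) → (∀ i, 0 ≤ s' i) → (∀ i, s' i ≤ cap i) →
      (a.isCustomer = true → ∀ i, s' i ≤ s i - a.bundle i * x) →
      (a.isCustomer = false → ∀ i, s' i ≤ s i + a.bundle i * x) →
      OfflineRun ε cap X S (σ ++ [a]) s' (y + x * a.offlineGain ε)

theorem offlineProfit_concat {n : ℕ} (ε : ℝ) (σ : Instance n) (a : Agent n) (x : ℕ → ℝ) :
    offlineProfit ε (σ ++ [a]) x = offlineProfit ε σ x + x σ.length * a.offlineGain ε := by
  induction σ generalizing x with
  | nil => simp [offlineProfit, Agent.offlineGain]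
  | cons b σ ih =>
    have key : ∀ τ : Instance n, offlineProfit ε (b :: τ) x =
        x 0 * b.offlineGain ε + offlineProfit ε τ fun t => x (t + 1) := fun τ => by
      unfold offlineProfit Agent.offlineGain
      exact Fin.sum_univ_succ (n := τ.length) _
    rw [List.cons_append, key, key, ih, add_assoc]
    rfl

theorem offlineProfit_congr {n : ℕ} (ε : ℝ) (σ : Instance n) {x x' : ℕ → ℝ}
    (h : ∀ t < σ.length, x t = x' t) : offlineProfit ε σ x = offlineProfit ε σ x' :=
  Finset.sum_congr rfl fun t _ => by rw [h t t.2]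

theorem OfflineRun.exists_isFeasible {n : ℕ} {ε : ℝ} {cap : Fin n → ℕ} {X S : Set ℝ}
    (hX : 0 ∈ X) (hS : 0 ∈ S) {σ : Instance n} {s : Fin n → ℝ} {y : ℝ}
    (h : OfflineRun ε cap X S σ s y) :
    ∃ x r, IsFeasible cap σ x r ∧ (∀ t, x t ∈ X) ∧ (∀ t i, r t i ∈ S) ∧
      r σ.length = s ∧ offlineProfit ε σ x = y := by
  induction h with
  | nil =>
    exact ⟨_, _, isFeasible_zero cap [], fun _ => hX, fun _ _ => hS, rfl, by simp [offlineProfit]⟩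
  | @concat σ s y a x₀ s' _ hx₀ h0 h1 hs'S hs'0 hs'c hsell hbuy ih =>
    obtain ⟨x, r, hf, hxX, hrS, hr, rfl⟩ := ih
    have hget : ∀ t (ht : t < (σ ++ [a]).length),
        (∃ h : t < σ.length, (σ ++ [a])[t] = σ[t]) ∨ (t = σ.length ∧ (σ ++ [a])[t] = a) := by
      intro t ht
      rcases Nat.lt_or_ge t σ.length with h | h
      · exact Or.inl ⟨h, List.getElem_append_left h⟩
      · have : t = σ.length := by simp at ht; omega
        subst this
        exact Or.inr ⟨rfl, by simp⟩
    have hsplit : ∀ {α : Type} (f : ℕ → α) (T : ℕ) (z : α) (P : α → Prop), P z → (∀ t, P (f t)) →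
        ∀ t, P (Function.update f T z t) := by
      intro α f T z P hz hf t
      by_cases ht : t = T
      · subst ht; simpa using hz
      · rw [Function.update_of_ne ht]; exact hf t
    refine ⟨Function.update x σ.length x₀, Function.update r (σ.length + 1) s',
      ⟨hsplit _ _ _ (0 ≤ ·) h0 hf.x_nonneg, hsplit _ _ _ (· ≤ 1) h1 hf.x_le_one,
        hsplit _ _ _ (fun f : Fin n → ℝ => ∀ i, 0 ≤ f i) hs'0 hf.r_nonneg,
        hsplit _ _ _ (fun f : Fin n → ℝ => ∀ i, f i ≤ cap i) hs'c hf.r_le, ?_, ?_⟩,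
      hsplit _ _ _ (· ∈ X) hx₀ hxX, hsplit _ _ _ (fun f : Fin n → ℝ => ∀ i, f i ∈ S) hs'S hrS, ?_, ?_⟩
    · rintro ⟨t, ht⟩ hc i
      rcases hget t ht with ⟨h, e⟩ | ⟨rfl, e⟩
      · simp only [Fin.getElem_fin, e] at hc ⊢
        rw [Function.update_of_ne (by omega), Function.update_of_ne (by omega),
          Function.update_of_ne (by omega)]
        exact hf.sell ⟨t, h⟩ hc i
      · simp only [Fin.getElem_fin, e] at hc ⊢
        rw [Function.update_self, Function.update_self, Function.update_of_ne (by omega), hr]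
        exact hsell hc i
    · rintro ⟨t, ht⟩ hc i
      rcases hget t ht with ⟨h, e⟩ | ⟨rfl, e⟩
      · simp only [Fin.getElem_fin, e] at hc ⊢
        rw [Function.update_of_ne (by omega), Function.update_of_ne (by omega),
          Function.update_of_ne (by omega)]
        exact hf.buy ⟨t, h⟩ hc i
      · simp only [Fin.getElem_fin, e] at hc ⊢
        rw [Function.update_self, Function.update_self, Function.update_of_ne (by omega), hr]
        exact hbuy hc i
    · simp
    · rw [offlineProfit_concat, Function.update_self]
      congr 1
      exact offlineProfit_congr ε σ fun t ht => Function.update_of_ne ht.ne _ _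

theorem OfflineRun.le_fracOpt {n : ℕ} {ε : ℝ} {cap : Fin n → ℕ} {σ : Instance n} {s : Fin n → ℝ}
    {y : ℝ} (h : OfflineRun ε cap Set.univ Set.univ σ s y) : y ≤ fracOpt ε cap σ := by
  obtain ⟨x, r, hf, -, -, -, rfl⟩ := h.exists_isFeasible (Set.mem_univ _) (Set.mem_univ _)
  exact OnlineTrading.le_fracOpt ε cap σ x r hf

theorem OfflineRun.le_intOpt {n : ℕ} {ε : ℝ} {cap : Fin n → ℕ} {σ : Instance n} {s : Fin n → ℝ}
    {y : ℝ} (h : OfflineRun ε cap {0, 1} (Set.range Nat.cast) σ s y) : y ≤ intOpt ε cap σ := by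
  obtain ⟨x, r, hf, hx, hr, -, rfl⟩ := h.exists_isFeasible (by simp) (Set.mem_range.2 ⟨0, Nat.cast_zero⟩)
  exact OnlineTrading.le_intOpt ε cap σ x r hf (fun t => by simpa using hx t)
    fun t i => (hr t i).imp fun q hq => hq.symm

/-- Rejecting all further agents, and emptying the stock, is always possible. -/
theorem OfflineRun.append_idle {n : ℕ} {ε : ℝ} {cap : Fin n → ℕ} {X S : Set ℝ} (hX : 0 ∈ X)
    (hS : 0 ∈ S) {σ : Instance n} {y : ℝ} (h : OfflineRun ε cap X S σ 0 y) (l : Instance n) :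
    OfflineRun ε cap X S (σ ++ l) 0 y := by
  induction l using List.reverseRecOn with
  | nil => simpa using h
  | append_singleton l a ih =>
    have := ih.concat a 0 0 hX le_rfl zero_le_one (fun _ => hS) (fun _ => le_rfl)
      (fun i => Nat.cast_nonneg _) (by simp) (by simp)
    simpa using this

/-! ### Instances with given parameters -/

/-- Appending agents with bundles of at most `d` items, where the customers have value `0` or a
value in `[1, v]`, keeps the parameters. -/
theorem HasParams.append {n d : ℕ} {v : ℝ} {σ l : Instance n} (h : HasParams σ d v) (hv : 0 ≤ v)
    (hl : ∀ a ∈ l, a.size ≤ d ∧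
      (a.isCustomer = true → a.value = 0 ∨ 1 ≤ a.value ∧ a.value ≤ v)) :
    HasParams (σ ++ l) d v := by
  obtain ⟨⟨⟨a₁, m₁, c₁⟩, u₁⟩, ⟨⟨a₂, m₂, c₂⟩, u₂⟩, ⟨⟨a₃, m₃, c₃⟩, u₃⟩⟩ := h
  refine ⟨⟨⟨a₁, List.mem_append_left _ m₁, c₁⟩, ?_⟩, ⟨⟨a₂, List.mem_append_left _ m₂, c₂⟩, ?_⟩,
    ⟨⟨a₃, List.mem_append_left _ m₃, c₃⟩, ?_⟩⟩
  · rintro k ⟨a, ha, hc, rfl⟩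
    rcases List.mem_append.1 ha with ha | ha
    · exact u₁ ⟨a, ha, hc, rfl⟩
    · exact (hl a ha).1
  · rintro k ⟨a, ha, hc, rfl, h0⟩
    rcases List.mem_append.1 ha with ha | ha
    · exact u₂ ⟨a, ha, hc, rfl, h0⟩
    · exact (((hl a ha).2 hc).resolve_left h0).1
  · rintro k ⟨a, ha, hc, rfl⟩
    rcases List.mem_append.1 ha with ha | ha
    · exact u₃ ⟨a, ha, hc, rfl⟩
    · rcases (hl a ha).2 hc with h | h
      · rw [h]; exact hv
      · exact h.2

/-- Two customers for the same bundle, with values `1` and `v`: they fix the parameters of an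
instance. -/
def seed {n : ℕ} (b : Fin n → ℕ) (v : ℝ) (hv : 0 ≤ v) : Instance n :=
  [⟨true, b, 1, zero_le_one⟩, ⟨true, b, v, hv⟩]

theorem hasParams_seed {n : ℕ} (b : Fin n → ℕ) {v : ℝ} (hv : 1 ≤ v) :
    HasParams (seed b v (zero_le_one.trans hv)) (∑ i, b i) v := by
  have h0 : v ≠ 0 := by linarith
  constructor
  · constructor
    · simp [seed, Agent.size]
    · rintro k ⟨a, ha, -, rfl⟩
      simp only [seed, List.mem_cons, List.not_mem_nil, or_false] at ha
      rcases ha with rfl | rfl <;> simp [Agent.size]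
  · constructor
    · simp [seed]
    · rintro k ⟨a, ha, -, rfl, -⟩
      simp only [seed, List.mem_cons, List.not_mem_nil, or_false] at ha
      rcases ha with rfl | rfl <;> simp [hv]
  · constructor
    · simp [seed]
    · rintro k ⟨a, ha, -, rfl⟩
      simp only [seed, List.mem_cons, List.not_mem_nil, or_false] at ha
      rcases ha with rfl | rfl <;> simp [hv]

theorem OnlineAlg.profit_seed_le {n : ℕ} {w : Fin n → ℕ} (A : OnlineAlg w) (b : Fin n → ℕ) {v : ℝ}
    (hv : 0 ≤ v) : A.profit (seed b v hv) ≤ 1 + v := by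
  have h1 := A.gain_le_value [] ⟨true, b, 1, zero_le_one⟩
  have h2 := A.gain_le_value [⟨true, b, 1, zero_le_one⟩] ⟨true, b, v, hv⟩
  simp only [profit, seed, profitFrom, List.nil_append]
  linarith

/-! ### Trading a single type at market prices -/

/-- A customer (`c = true`) or supplier (`c = false`) of `b` units of type `i`, with value `x`. -/
def singleAgent {n : ℕ} (i : Fin n) (c : Bool) (b : ℕ) (x : ℝ) (hx : 0 ≤ x) : Agent n :=
  ⟨c, Pi.single i b, x, hx⟩

theorem size_singleAgent {n : ℕ} (i : Fin n) (c : Bool) (b : ℕ) (x : ℝ) (hx : 0 ≤ x) :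
    (singleAgent i c b x hx).size = b := by
  simp [singleAgent, Agent.size]

/-- An agent who does not pay more than the price `p` per unit of type `i`, or does not sell for
less: then trading does not increase the value of money and stock at price `p`. -/
def Agent.IsFair {n : ℕ} (i : Fin n) (p : ℝ) (a : Agent n) : Prop :=
  (a.isCustomer = true → a.value ≤ a.bundle i * p) ∧
    (a.isCustomer = false → a.bundle i * p ≤ a.value)

theorem OnlineAlg.wealth_append_le {n : ℕ} {w : Fin n → ℕ} (A : OnlineAlg w) {i : Fin n} {p : ℝ}
    (hp : 0 ≤ p) (h l : Instance n) (hl : ∀ a ∈ l, a.IsFair i p) :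
    A.profit (h ++ l) + A.inv (h ++ l) i * p ≤ A.profit h + A.inv h i * p := by
  induction l using List.reverseRecOn with
  | nil => simp
  | append_singleton l a ih =>
    refine le_trans ?_ (ih fun b hb => hl b (by simp [hb]))
    have ha : a.IsFair i p := hl a (by simp)
    rw [← List.append_assoc]
    generalize h ++ l = g
    rw [A.profit_concat, OnlineAlg.gain]
    cases hacc : A.accept g a with
    | false =>
      have h1 : (A.inv (g ++ [a]) i : ℝ) ≤ A.inv g i := by exact_mod_cast A.inv_reject g a hacc i
      have := mul_le_mul_of_nonneg_right h1 hp
      simpa using this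
    | true =>
      cases hc : a.isCustomer with
      | true =>
        have h1 : (A.inv (g ++ [a]) i + a.bundle i : ℝ) ≤ A.inv g i := by
          exact_mod_cast A.inv_sell g a hacc hc i
        have := mul_le_mul_of_nonneg_right h1 hp
        have := ha.1 hc
        simp only [if_true]
        linarith
      | false =>
        have h1 : (A.inv (g ++ [a]) i : ℝ) ≤ A.inv g i + a.bundle i := by
          exact_mod_cast A.inv_buy g a hacc hc i
        have := mul_le_mul_of_nonneg_right h1 hp
        have := ha.2 hc
        simp only [if_true, Bool.false_eq_true, if_false]
        linarith

theorem OfflineRun.append_suppliers {n : ℕ} {ε : ℝ} {w : Fin n → ℕ} {i : Fin n} {σ : Instance n}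
    {y : ℝ} (h : OfflineRun ε w Set.univ Set.univ σ 0 y) (p : ℝ) (hp : 0 ≤ p) (j : ℕ)
    (hj : j ≤ w i) :
    OfflineRun ε w Set.univ Set.univ (σ ++ List.replicate j (singleAgent i false 1 p hp))
      (Pi.single i (j : ℝ)) (y - j * ((1 + ε) * p)) := by
  induction j with
  | zero => simpa using h
  | succ j ih =>
    have hj' : (j : ℝ) + 1 ≤ w i := by exact_mod_cast hj
    have := (ih (by omega)).concat (singleAgent i false 1 p hp) 1 (Pi.single i ((j + 1 : ℕ) : ℝ))
      trivial zero_le_one le_rfl (fun _ => trivial) ?_ ?_ (by simp [singleAgent]) ?_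
    · convert this using 1
      · rw [List.replicate_succ', List.append_assoc]
      · simp [singleAgent, Agent.offlineGain]; ring
    all_goals
      intros
      rename_i k
      by_cases hk : k = i
      · subst hk; simp [singleAgent]; try positivity
        try exact hj'
      · simp [hk, singleAgent]

theorem OfflineRun.append_customers {n : ℕ} {ε : ℝ} {w : Fin n → ℕ} {i : Fin n} {σ : Instance n}
    {y : ℝ} {b : ℕ} (hb : 1 ≤ b) (x : ℝ) (hx : 0 ≤ x) (j : ℕ) (hj : j ≤ w i)
    (h : OfflineRun ε w Set.univ Set.univ σ (Pi.single i (j : ℝ)) y) :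
    OfflineRun ε w Set.univ Set.univ (σ ++ List.replicate j (singleAgent i true b x hx))
      0 (y + j * (x / b)) := by
  induction j generalizing σ y with
  | zero => simpa using h
  | succ j ih =>
    have hj' : (j : ℝ) + 1 ≤ w i := by exact_mod_cast hj
    have hb' : (1 : ℝ) ≤ b := by exact_mod_cast hb
    have hb0 : (b : ℝ) ≠ 0 := by positivity
    have h1 := h.concat (singleAgent i true b x hx) (1 / b) (Pi.single i (j : ℝ))
      trivial (by positivity) ((div_le_one (by positivity)).2 hb') (fun _ => trivial) ?_ ?_ ?_
      (by simp [singleAgent])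
    · have h2 := ih (by omega) h1
      convert h2 using 1
      · rw [List.replicate_succ, List.append_assoc]; rfl
      · simp [singleAgent, Agent.offlineGain]; field_simp; ring
    all_goals
      intros
      rename_i k
      by_cases hk : k = i
      · subst hk; simp [singleAgent, hb0]; try linarith
      · simp [hk, singleAgent]

/-! ### Random adversaries -/

/-- A Markov chain that generates random instances with a single item type, together with a
certificate that no algorithm is `ρ`-competitive on them.

In state `s`, suppliers offer single units at price `price s`. Then a coin with bias `prob s` gives
a side `k`, the market price per unit becomes `market s k`, customers ask for `size s k` units at
total value `value s k`, and the chain moves to `next s k`.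

`drift s` bounds the expected increase of the price, so the expected gain per unit of stock of an
online algorithm, and `gain s k` is a profit per unit of stock that an offline solution can make.
The inequality `balance` says that, up to the bounded function `potential`, the expected offline
gain exceeds `ρ` times the online one by `δ > 0` in each step. -/
structure MarketAdversary (ε ρ : ℝ) (d : ℕ) (v : ℝ) where
  valid : Set ℕ
  start : ℕ
  price : ℕ → ℝ
  prob : ℕ → ℝ
  next : ℕ → Bool → ℕ
  market : ℕ → Bool → ℝ
  size : ℕ → Bool → ℕ
  value : ℕ → Bool → ℝ
  gain : ℕ → Bool → ℝ
  drift : ℕ → ℝ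
  potential : ℕ → ℝ
  potentialBound : ℝ
  δ : ℝ
  start_mem : start ∈ valid
  next_mem : ∀ s ∈ valid, ∀ k, next s k ∈ valid
  price_nonneg : ∀ s, 0 ≤ price s
  prob_nonneg : ∀ s, 0 ≤ prob s
  prob_le_one : ∀ s, prob s ≤ 1
  price_next_le : ∀ s ∈ valid, ∀ k, price (next s k) ≤ market s k
  one_le_size : ∀ s ∈ valid, ∀ k, 1 ≤ size s k
  size_le : ∀ s ∈ valid, ∀ k, size s k ≤ d
  value_nonneg : ∀ s k, 0 ≤ value s k
  value_range : ∀ s ∈ valid, ∀ k, value s k = 0 ∨ 1 ≤ value s k ∧ value s k ≤ v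
  value_le : ∀ s ∈ valid, ∀ k, value s k ≤ size s k * market s k
  gain_le : ∀ s ∈ valid, ∀ k, gain s k ≤ 0 ∨
    gain s k ≤ value s k / size s k - (1 + ε) * price s
  drift_nonneg : ∀ s ∈ valid, 0 ≤ drift s
  le_drift : ∀ s ∈ valid,
    prob s * market s true + (1 - prob s) * market s false - price s ≤ drift s
  potential_le : ∀ s ∈ valid, potential s ≤ potentialBound
  δ_pos : 0 < δ
  balance : ∀ s ∈ valid, potential s + δ ≤ prob s * (gain s true + potential (next s true)) +
    (1 - prob s) * (gain s false + potential (next s false)) - ρ * drift s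

namespace MarketAdversary

variable {ε ρ : ℝ} {d : ℕ} {v : ℝ} (M : MarketAdversary ε ρ d v) {n : ℕ} (i : Fin n) (W : ℕ)

/-- The suppliers in state `s`. -/
def suppliers (s : ℕ) : Instance n :=
  List.replicate W (singleAgent i false 1 (M.price s) (M.price_nonneg s))

/-- The customers after the coin shows `k` in state `s`. -/
def customers (s : ℕ) (k : Bool) : Instance n :=
  List.replicate W (singleAgent i true (M.size s k) (M.value s k) (M.value_nonneg s k))

/-- The expectation of `F` on the random instance that extends `h` by `T` steps of the chain from
state `s`. -/
def expect (F : Instance n → ℝ) : ℕ → ℕ → Instance n → ℝ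
  | 0, _, h => F h
  | T + 1, s, h =>
    M.prob s * expect F T (M.next s true) (h ++ M.suppliers i W s ++ M.customers i W s true) +
      (1 - M.prob s) *
        expect F T (M.next s false) (h ++ M.suppliers i W s ++ M.customers i W s false)

theorem expect_le {F : Instance n → ℝ} {K : Set (Instance n)} {C : ℝ} (hF : ∀ σ ∈ K, F σ ≤ C)
    (hK : ∀ h ∈ K, ∀ s ∈ M.valid, ∀ k, h ++ M.suppliers i W s ++ M.customers i W s k ∈ K)
    (T s : ℕ) (h : Instance n) (hs : s ∈ M.valid) (hh : h ∈ K) : M.expect i W F T s h ≤ C := by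
  induction T generalizing s h with
  | zero => exact hF h hh
  | succ T ih =>
    have h0 := M.prob_nonneg s
    have h1 := M.prob_le_one s
    have ht := ih _ _ (M.next_mem s hs true) (hK h hh s hs true)
    have hf := ih _ _ (M.next_mem s hs false) (hK h hh s hs false)
    simp only [expect]
    nlinarith [mul_le_mul_of_nonneg_left ht h0,
      mul_le_mul_of_nonneg_left hf (sub_nonneg.2 h1)]

theorem integrable_expect {Ω : Type*} [MeasurableSpace Ω] {μ : Measure Ω}
    {F : Ω → Instance n → ℝ} (hF : ∀ σ, Integrable (fun ω => F ω σ) μ) (T s : ℕ)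
    (h : Instance n) : Integrable (fun ω => M.expect i W (F ω) T s h) μ := by
  induction T generalizing s h with
  | zero => exact hF h
  | succ T ih => exact ((ih _ _).const_mul _).add ((ih _ _).const_mul _)

theorem expect_integral {Ω : Type*} [MeasurableSpace Ω] {μ : Measure Ω}
    {F : Ω → Instance n → ℝ} (hF : ∀ σ, Integrable (fun ω => F ω σ) μ) (T s : ℕ)
    (h : Instance n) :
    M.expect i W (fun σ => ∫ ω, F ω σ ∂μ) T s h = ∫ ω, M.expect i W (F ω) T s h ∂μ := by
  induction T generalizing s h with
  | zero => rfl
  | succ T ih =>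
    simp only [expect, ih]
    rw [integral_add ((M.integrable_expect i W hF _ _ _).const_mul _)
      ((M.integrable_expect i W hF _ _ _).const_mul _), integral_const_mul, integral_const_mul]

/-- One block: buying a full stock at the price of state `s` and selling it, or doing nothing,
yields the offline gain. -/
theorem exists_offlineRun {w : Fin n → ℕ} {h : Instance n} {y : ℝ} {s : ℕ} (hs : s ∈ M.valid)
    (k : Bool) (hy : OfflineRun ε w Set.univ Set.univ h 0 y) :
    ∃ y', y + w i * M.gain s k ≤ y' ∧ OfflineRun ε w Set.univ Set.univ
      (h ++ M.suppliers i (w i) s ++ M.customers i (w i) s k) 0 y' := by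
  rcases M.gain_le s hs k with hg | hg
  · refine ⟨y, ?_, ?_⟩
    · have : (0 : ℝ) ≤ w i := Nat.cast_nonneg _
      nlinarith
    · rw [List.append_assoc]
      exact hy.append_idle (Set.mem_univ _) (Set.mem_univ _) _
  · refine ⟨_, ?_, (hy.append_suppliers (M.price s) (M.price_nonneg s) (w i) le_rfl
      ).append_customers (M.one_le_size s hs k) (M.value s k) (M.value_nonneg s k) (w i) le_rfl⟩
    have := mul_le_mul_of_nonneg_left hg (Nat.cast_nonneg (α := ℝ) (w i))
    linarith

/-- The price is a supermartingale up to the drift, so money plus stock at the current price hardly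
grows, while the offline profit does. -/
theorem le_expect {w : Fin n → ℕ} (hρ : 0 ≤ ρ) (A : OnlineAlg w) (T s : ℕ) (h : Instance n) (y : ℝ)
    (hs : s ∈ M.valid) (hy : OfflineRun ε w Set.univ Set.univ h 0 y) :
    y - ρ * (A.profit h + A.inv h i * M.price s) +
        w i * (M.potential s - M.potentialBound + T * M.δ) ≤
      M.expect i (w i) (fun σ => fracOpt ε w σ - ρ * A.profit σ) T s h := by
  have hw : (0 : ℝ) ≤ w i := Nat.cast_nonneg _
  induction T generalizing s h y with
  | zero =>
    have h1 := hy.le_fracOpt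
    have h2 : 0 ≤ ρ * (A.inv h i * M.price s) :=
      mul_nonneg hρ (mul_nonneg (Nat.cast_nonneg _) (M.price_nonneg s))
    have h3 := mul_le_mul_of_nonneg_left (sub_nonpos.2 (M.potential_le s hs)) hw
    simp only [expect]
    push_cast
    linarith
  | succ T ih =>
    set g := h ++ M.suppliers i (w i) s with hg
    -- The stock after the suppliers does not depend on the coin: the algorithm is online.
    have hbuy : A.profit g + A.inv g i * M.price s ≤ A.profit h + A.inv h i * M.price s := by
      refine A.wealth_append_le (M.price_nonneg s) h _ fun a ha => ?_
      rw [List.eq_of_mem_replicate ha]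
      simp [Agent.IsFair, singleAgent]
    have hstep : ∀ k, ∃ y', y + w i * M.gain s k ≤ y' ∧
        y' - ρ * (A.profit g + A.inv g i * M.market s k) +
          w i * (M.potential (M.next s k) - M.potentialBound + T * M.δ) ≤
        M.expect i (w i) (fun σ => fracOpt ε w σ - ρ * A.profit σ) T (M.next s k)
          (g ++ M.customers i (w i) s k) := by
      intro k
      obtain ⟨y', hyy', hrun⟩ := M.exists_offlineRun i hs k hy
      refine ⟨y', hyy', le_trans ?_ (ih _ _ y' (M.next_mem s hs k) hrun)⟩
      have hm : 0 ≤ M.market s k := (M.price_nonneg _).trans (M.price_next_le s hs k)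
      have hsell : A.profit (g ++ M.customers i (w i) s k) +
          A.inv (g ++ M.customers i (w i) s k) i * M.market s k ≤
          A.profit g + A.inv g i * M.market s k := by
        refine A.wealth_append_le hm g _ fun a ha => ?_
        rw [List.eq_of_mem_replicate ha]
        simpa [Agent.IsFair, singleAgent] using M.value_le s hs k
      have hnext := mul_le_mul_of_nonneg_left (M.price_next_le s hs k)
        (Nat.cast_nonneg (α := ℝ) (A.inv (g ++ M.customers i (w i) s k) i))
      have := mul_le_mul_of_nonneg_left
        ((add_le_add_right hnext (A.profit (g ++ M.customers i (w i) s k))).trans hsell) hρ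
      linarith
    obtain ⟨yt, hyt, ht⟩ := hstep true
    obtain ⟨yf, hyf, hf⟩ := hstep false
    have h0 := M.prob_nonneg s
    have h1 := sub_nonneg.2 (M.prob_le_one s)
    have hr : (A.inv g i : ℝ) * (M.prob s * M.market s true +
        (1 - M.prob s) * M.market s false - M.price s) ≤ w i * M.drift s :=
      (mul_le_mul_of_nonneg_left (M.le_drift s hs) (Nat.cast_nonneg _)).trans
        (mul_le_mul_of_nonneg_right (by exact_mod_cast A.inv_le g i) (M.drift_nonneg s hs))
    have e1 := mul_le_mul_of_nonneg_left ht h0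
    have e2 := mul_le_mul_of_nonneg_left hf h1
    have e3 := mul_le_mul_of_nonneg_left hyt h0
    have e4 := mul_le_mul_of_nonneg_left hyf h1
    have e5 := mul_le_mul_of_nonneg_left hr hρ
    have e6 := mul_le_mul_of_nonneg_left hbuy hρ
    have e7 := mul_le_mul_of_nonneg_left (M.balance s hs) hw
    simp only [expect]
    push_cast
    linarith

/-- A randomized algorithm is not `ρ`-competitive if there is an adversary against `ρ`. -/
theorem not_isCompetitive (M : MarketAdversary ε ρ d v) (hρ : 0 ≤ ρ)
    (hd : 1 ≤ d) (hv : 1 ≤ v) {w : Fin n → ℕ}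
    (hw : 1 ≤ w i) {Ω : Type*} [MeasurableSpace Ω] (μ : Measure Ω) [IsProbabilityMeasure μ]
    (R : RandomizedAlg w Ω) :
    ¬ IsCompetitive (singleTypeInstances i d v) (fracOpt ε w) (R.expectedProfit μ) ρ := by
  rintro ⟨C, hC⟩
  have hv0 : 0 ≤ v := zero_le_one.trans hv
  set h₀ : Instance n := seed (Pi.single i d) v hv0 with hh₀
  have hseed : h₀ ∈ singleTypeInstances i d v := by
    constructor
    · simpa [hh₀] using hasParams_seed (Pi.single i d : Fin n → ℕ) hv
    · intro a ha
      simp only [hh₀, seed, List.mem_cons, List.not_mem_nil, or_false] at ha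
      rcases ha with rfl | rfl <;> simp +contextual [Agent.size]
  have hK : ∀ h ∈ singleTypeInstances i d v, ∀ s ∈ M.valid, ∀ k,
      h ++ M.suppliers i (w i) s ++ M.customers i (w i) s k ∈ singleTypeInstances i d v := by
    rintro h ⟨hp, hb⟩ s hs k
    have hmem : ∀ a ∈ M.suppliers i (w i) s ++ M.customers i (w i) s k, (a.size ≤ d ∧
        (a.isCustomer = true → a.value = 0 ∨ 1 ≤ a.value ∧ a.value ≤ v)) ∧
        ∀ j, j ≠ i → a.bundle j = 0 := by
      intro a ha
      rcases List.mem_append.1 ha with ha | ha <;> rw [List.eq_of_mem_replicate ha]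
      · refine ⟨⟨by rwa [size_singleAgent], by simp [singleAgent]⟩, fun j hj => ?_⟩
        simp [singleAgent, hj]
      · refine ⟨⟨by rw [size_singleAgent]; exact M.size_le s hs k,
          fun _ => M.value_range s hs k⟩, fun j hj => ?_⟩
        simp [singleAgent, hj]
    rw [List.append_assoc]
    refine ⟨hp.append hv0 fun a ha => (hmem a ha).1, fun a ha => ?_⟩
    rcases List.mem_append.1 ha with ha | ha
    · exact hb a ha
    · exact ⟨(hmem a ha).1.1, (hmem a ha).2⟩
  have hseedrun : OfflineRun ε w Set.univ Set.univ h₀ 0 0 := by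
    simpa using OfflineRun.nil.append_idle (ε := ε) (cap := w) (Set.mem_univ 0)
      (Set.mem_univ 0) h₀
  set F : Ω → Instance n → ℝ := fun ω σ => fracOpt ε w σ - ρ * (R.alg ω).profit σ with hFdef
  have hF : ∀ σ, Integrable (fun ω => F ω σ) μ := fun σ =>
    (integrable_const _).sub ((R.integrable_profit μ σ).const_mul ρ)
  have hint : ∀ σ, ∫ ω, F ω σ ∂μ = fracOpt ε w σ - ρ * R.expectedProfit μ σ := fun σ => by
    rw [integral_sub (integrable_const _) ((R.integrable_profit μ σ).const_mul ρ),
      integral_const_mul]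
    simp [RandomizedAlg.expectedProfit]
  set B : ℝ := -(ρ * ((1 + v) + w i * M.price M.start)) +
    w i * (M.potential M.start - M.potentialBound) with hB
  have hlow : ∀ T : ℕ, B + T * (w i * M.δ) ≤ C := by
    intro T
    have hup := M.expect_le i (w i) (F := fun σ => ∫ ω, F ω σ ∂μ) (C := C)
      (fun σ hσ => by rw [hint]; linarith [hC σ hσ]) hK T M.start h₀ M.start_mem hseed
    rw [M.expect_integral i (w i) hF] at hup
    refine le_trans ?_ hup
    have hpt : ∀ ω, B + T * (w i * M.δ) ≤ M.expect i (w i) (F ω) T M.start h₀ := by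
      intro ω
      refine le_trans ?_ (M.le_expect i hρ (R.alg ω) T M.start h₀ 0 M.start_mem hseedrun)
      have h1 := (R.alg ω).profit_seed_le (Pi.single i d) hv0
      have h2 : ((R.alg ω).inv h₀ i : ℝ) ≤ w i := by exact_mod_cast (R.alg ω).inv_le h₀ i
      have h3 := mul_le_mul_of_nonneg_right h2 (M.price_nonneg M.start)
      have h4 := mul_le_mul_of_nonneg_left (add_le_add h1 h3) hρ
      rw [hB]
      linarith
    calc B + T * (w i * M.δ) = ∫ _, B + T * (w i * M.δ) ∂μ := by simp
      _ ≤ _ := integral_mono (integrable_const _) (M.integrable_expect i (w i) hF _ _ _) hpt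
  have hpos : 0 < w i * M.δ := mul_pos (by exact_mod_cast hw) M.δ_pos
  obtain ⟨T, hT⟩ := exists_nat_gt ((C - B) / (w i * M.δ))
  rw [div_lt_iff₀ hpos] at hT
  linarith [hlow T]

/-- A deterministic algorithm is a randomized one on a one-point probability space. -/
theorem not_isCompetitive_deterministic (M : MarketAdversary ε ρ d v) (hρ : 0 ≤ ρ)
    (hd : 1 ≤ d) (hv : 1 ≤ v) {w : Fin n → ℕ}
    (hw : 1 ≤ w i) (A : OnlineAlg w) :
    ¬ IsCompetitive (singleTypeInstances i d v) (fracOpt ε w) A.profit ρ := by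
  set R : RandomizedAlg w Unit := ⟨fun _ => A, fun _ _ => measurable_const⟩
  have hR : R.expectedProfit (Measure.dirac ()) = A.profit :=
    funext fun σ => by simp [RandomizedAlg.expectedProfit, R]
  exact hR ▸ M.not_isCompetitive i hρ hd hv hw (Measure.dirac ()) R

end MarketAdversary

/-! ### Three random adversaries -/

namespace MarketAdversary

/-- Free supply followed by customers with value `1`: no algorithm is better than the optimum. -/
def freeSupply (ε : ℝ) {ρ : ℝ} (hρ : ρ < 1) {d : ℕ} (hd : 1 ≤ d) {v : ℝ} (hv : 1 ≤ v) :
    MarketAdversary ε ρ d v where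
  valid := Set.univ
  start := 0
  price _ := 0
  prob _ := 1
  next _ _ := 0
  market _ _ := 1
  size _ _ := 1
  value _ _ := 1
  gain _ _ := 1
  drift _ := 1
  potential _ := 0
  potentialBound := 0
  δ := 1 - ρ
  start_mem := trivial
  next_mem _ _ _ := trivial
  price_nonneg _ := le_rfl
  prob_nonneg _ := zero_le_one
  prob_le_one _ := le_rfl
  price_next_le _ _ _ := zero_le_one
  one_le_size _ _ _ := le_rfl
  size_le _ _ _ := hd
  value_nonneg _ _ := zero_le_one
  value_range _ _ _ := Or.inr ⟨le_rfl, hv⟩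
  value_le _ _ _ := by simp
  gain_le _ _ _ := by simp
  drift_nonneg _ _ := zero_le_one
  le_drift _ _ := by simp
  potential_le _ _ := le_rfl
  δ_pos := sub_pos.2 hρ
  balance _ _ := by simp

/-- Without augmentation: in state `j < J` the price `1 - 2 ^ (j - J)` either jumps to `1`, where
customers buy, or the distance to `1` doubles, each with probability `1 / 2`. So the price is a
martingale, apart from the reset when it has dropped to `0`, which has probability `2 ^ (-J)` per
cycle. The expected offline gain per cycle is `2 ^ (-J) * J / 2` before that. -/
noncomputable def doublingGap {ρ : ℝ} {J : ℕ} (hJ : 2 * ρ ≤ J) {d : ℕ} (hd : 1 ≤ d) {v : ℝ}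
    (hv : 1 ≤ v) : MarketAdversary 0 ρ d v where
  valid := {j | j ≤ J}
  start := 0
  price j := max 0 (1 - 2 ^ j / 2 ^ J)
  prob _ := 1 / 2
  next j k := if k = true ∨ J ≤ j then 0 else j + 1
  market j k := if k = true ∨ J ≤ j then 1 else max 0 (1 - 2 ^ (j + 1) / 2 ^ J)
  size _ _ := 1
  value j k := if k = true ∨ J ≤ j then 1 else 0
  gain j k := if k = true ∨ J ≤ j then 2 ^ j / 2 ^ J else 0
  drift j := if J ≤ j then 1 else 0
  potential j := -(j / 2 * (2 ^ j / 2 ^ J)) + (2 ^ j - 1) / 2 ^ J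
  potentialBound := 1
  δ := 1 / 2 / 2 ^ J
  start_mem := Nat.zero_le J
  next_mem j hj k := by
    simp only [Set.mem_ofPred_eq]
    split_ifs with h
    · exact Nat.zero_le J
    · push Not at h
      exact h.2
  price_nonneg _ := le_max_left _ _
  prob_nonneg _ := by norm_num
  prob_le_one _ := by norm_num
  price_next_le j hj k := by
    split_ifs with h
    · exact max_le zero_le_one (sub_le_self _ (by positivity))
    · exact le_rfl
  one_le_size _ _ _ := le_rfl
  size_le _ _ _ := hd
  value_nonneg j k := by split_ifs <;> norm_num
  value_range j _ k := by
    split_ifs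
    · exact Or.inr ⟨le_rfl, hv⟩
    · exact Or.inl rfl
  value_le j _ k := by
    split_ifs <;> simp
  gain_le j hj k := by
    have h1 : (2 : ℝ) ^ j / 2 ^ J ≤ 1 :=
      (div_le_one (by positivity)).2 (pow_le_pow_right₀ one_le_two hj)
    split_ifs
    · right
      rw [max_eq_right (by linarith)]
      simp
    · exact Or.inl le_rfl
  drift_nonneg j _ := by split_ifs <;> norm_num
  le_drift j hj := by
    simp only [true_or, if_true, Bool.false_eq_true, false_or]
    split_ifs with h
    · have := le_max_left (0 : ℝ) (1 - 2 ^ j / 2 ^ J)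
      linarith
    · have h1 : (2 : ℝ) ^ (j + 1) / 2 ^ J ≤ 1 :=
        (div_le_one (by positivity)).2 (pow_le_pow_right₀ one_le_two (not_le.1 h))
      rw [max_eq_right (by linarith)]
      refine (sub_le_sub_left (le_max_right _ _) _).trans (le_of_eq ?_)
      ring
  potential_le j hj := by
    have h1 : (2 : ℝ) ^ j / 2 ^ J ≤ 1 :=
      (div_le_one (by positivity)).2 (pow_le_pow_right₀ one_le_two hj)
    have h2 : (0 : ℝ) ≤ j / 2 * (2 ^ j / 2 ^ J) := by positivity
    have h3 : (0 : ℝ) ≤ 1 / 2 ^ J := by positivity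
    rw [sub_div]
    linarith
  δ_pos := by positivity
  balance j hj := by
    simp only [true_or, if_true, Bool.false_eq_true, false_or]
    split_ifs with h
    · obtain rfl : j = J := le_antisymm hj h
      have h2 : (0 : ℝ) < 2 ^ j := by positivity
      rw [div_self h2.ne', sub_div, div_self h2.ne', div_div]
      have h3 : (0 : ℝ) < 1 / (2 * 2 ^ j) := by positivity
      have h4 : (1 : ℝ) / 2 ^ j = 2 * (1 / (2 * 2 ^ j)) := by field_simp
      simp only [Nat.cast_zero, pow_zero, sub_self, zero_div]
      linarith
    · refine le_of_eq ?_
      push_cast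
      field_simp
      ring

/-- The size of a bundle that is sold at a price `p` per unit, such that its value is at least
`1`. -/
theorem ceil_bundle {D : ℕ} {v p : ℝ} (hD : D = 1 ∨ 2 ≤ v) (hp0 : 0 < p) (hp : 1 ≤ p * D)
    (hpv : p ≤ v) : 1 ≤ ⌈1 / p⌉₊ ∧ ⌈1 / p⌉₊ ≤ D ∧ 1 ≤ ⌈1 / p⌉₊ * p ∧ ⌈1 / p⌉₊ * p ≤ v := by
  refine ⟨Nat.one_le_ceil_iff.2 (by positivity), Nat.ceil_le.2 ?_, ?_, ?_⟩
  · rwa [div_le_iff₀ hp0, mul_comm]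
  · exact (div_le_iff₀ hp0).1 (Nat.le_ceil _)
  · rcases le_or_gt 1 p with h1 | h1
    · have : (⌈1 / p⌉₊ : ℝ) ≤ 1 := by
        exact_mod_cast Nat.ceil_le.2 (by rw [Nat.cast_one]; exact (div_le_one hp0).2 h1)
      exact (mul_le_of_le_one_left hp0.le this).trans hpv
    · rcases hD with rfl | hv
      · rw [Nat.cast_one, mul_one] at hp
        linarith
      · have h2 := mul_lt_mul_of_pos_right (Nat.ceil_lt_add_one (by positivity : 0 ≤ 1 / p)) hp0
        rw [add_mul, one_div_mul_cancel hp0.ne'] at h2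
        linarith

/-- With augmentation: the price is `u ^ j / D` with `u = 1 + 2 * ε`, where `j` is a random walk on
`{0, …, J}`, reflected at both ends, that goes up with probability `1 / (1 + u)`, so that the price
is a martingale inside. An offline solution gains `ε` times the price whenever the price goes up.
An online algorithm gains only at `j = 0`, a fraction `2 * ε` of the price. The first part of the
potential makes the offline gains equivalent to `ε * J / D` per visit of `0`. The second one, a
multiple of `j`, uses the downward bias of the walk to make every step a strict gain. -/
noncomputable def reflectedWalk {ε ρ : ℝ} (hε : 0 < ε) {D J d : ℕ} (hD : 1 ≤ D) (hDd : D ≤ d)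
    {v : ℝ} (hDv : D = 1 ∨ 2 ≤ v) (hJ : 1 ≤ J) (hJv : (1 + 2 * ε) ^ J ≤ D * v)
    (hρ : ρ < J / 2) : MarketAdversary ε ρ d v :=
  let next : ℕ → Bool → ℕ := fun j k =>
    if k = true then (if j < J then j + 1 else J - 1) else (if j = 0 then 1 else j - 1)
  let price : ℕ → ℝ := fun j => (1 + 2 * ε) ^ j / D
  have hD0 : (0 : ℝ) < D := by exact_mod_cast hD
  have hprice : ∀ j, 0 < price j := fun j => by positivity
  have hnext : ∀ j ≤ J, ∀ k, next j k ≤ J := fun j hj k => by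
    simp only [next]
    split_ifs <;> omega
  have hrange : ∀ j ≤ J, 1 ≤ price j * D ∧ price j ≤ v := fun j hj => by
    constructor
    · rw [div_mul_cancel₀ _ hD0.ne']
      exact one_le_pow₀ (by linarith)
    · rw [div_le_iff₀ hD0, mul_comm v]
      exact (pow_le_pow_right₀ (by linarith) hj).trans hJv
  have hbundle := fun j (hj : j ≤ J) k =>
    ceil_bundle hDv (hprice (next j k)) (hrange _ (hnext j hj k)).1 (hrange _ (hnext j hj k)).2
  have hκ : 0 < ε * (J / 2 - ρ) := mul_pos hε (sub_pos.2 hρ)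
  { valid := {j | j ≤ J}
    start := 0
    price := price
    prob := fun _ => 1 / (2 + 2 * ε)
    next := next
    market := fun j k => price (next j k)
    size := fun j k => ⌈1 / price (next j k)⌉₊
    value := fun j k => ⌈1 / price (next j k)⌉₊ * price (next j k)
    gain := fun j k => if next j k = j + 1 then ε * (1 + 2 * ε) ^ j / D else 0
    drift := fun j => if j = 0 then 2 * ε / D else 0
    potential := fun j =>
      ((J + 1 / (2 * ε) - j) * (1 + 2 * ε) ^ j / 2 - ε * (J / 2 - ρ) * j) / D
    potentialBound := ((J + 1 / (2 * ε)) * (1 + 2 * ε) ^ J / 2) / D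
    δ := ε * (J / 2 - ρ) * (ε / (1 + ε)) / D
    start_mem := Nat.zero_le J
    next_mem := hnext
    price_nonneg := fun j => (hprice j).le
    prob_nonneg := fun _ => by positivity
    prob_le_one := fun _ => (div_le_one (by positivity)).2 (by linarith)
    price_next_le := fun _ _ _ => le_rfl
    one_le_size := fun j hj k => (hbundle j hj k).1
    size_le := fun j hj k => (hbundle j hj k).2.1.trans hDd
    value_nonneg := fun j k => mul_nonneg (Nat.cast_nonneg _) (hprice _).le
    value_range := fun j hj k => Or.inr (hbundle j hj k).2.2
    value_le := fun _ _ _ => le_rfl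
    gain_le := fun j hj k => by
      have h0 : (⌈1 / price (next j k)⌉₊ : ℝ) ≠ 0 := by
        have := (hbundle j hj k).1
        positivity
      rw [mul_div_cancel_left₀ _ h0]
      split_ifs with h
      · right
        rw [h]
        refine le_of_eq ?_
        simp only [price]
        field_simp
        ring
      · exact Or.inl le_rfl
    drift_nonneg := fun j _ => by
      split_ifs
      · positivity
      · exact le_rfl
    le_drift := fun j hj => by
      rcases j with _ | i
      · have h0 : 0 < J := hJ
        simp only [next, price, if_true, h0, Bool.false_eq_true, if_false]
        refine le_of_eq ?_
        field_simp
        ring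
      · have hi : i + 1 ≠ 0 := by omega
        simp only [next, if_true, Bool.false_eq_true, if_false, hi, Nat.add_sub_cancel]
        split_ifs with h
        · refine le_of_eq ?_
          simp only [price]
          field_simp
          ring
        · obtain rfl : i + 1 = J := le_antisymm hj (not_lt.1 h)
          have : price i ≤ price (i + 1) := by
            simp only [price]
            gcongr
            · linarith
            · omega
          simp only [Nat.add_sub_cancel]
          linarith
    potential_le := fun j hj => by
      have h1 : (0 : ℝ) ≤ ε * (J / 2 - ρ) * j := by positivity
      have h2 : (0 : ℝ) ≤ j * (1 + 2 * ε) ^ j := by positivity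
      have h3 : (J + 1 / (2 * ε)) * (1 + 2 * ε) ^ j ≤ (J + 1 / (2 * ε)) * (1 + 2 * ε) ^ J := by
        gcongr
        · linarith
        · exact hj
      gcongr
      linarith
    δ_pos := by positivity
    balance := fun j hj => by
      have hfrac : ε / (1 + ε) ≤ 1 := (div_le_one (by positivity)).2 (by linarith)
      have hδ : ε * (J / 2 - ρ) * (ε / (1 + ε)) / D ≤ ε * (J / 2 - ρ) / D :=
        div_le_div_of_nonneg_right (mul_le_of_le_one_right hκ.le hfrac) hD0.le
      rcases j with _ | i
      · have h0 : 0 < J := hJ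
        simp only [next, if_true, h0, Bool.false_eq_true, if_false]
        refine (add_le_add le_rfl hδ).trans (le_of_eq ?_)
        push_cast
        field_simp
        ring
      · have hi : i + 1 ≠ 0 := by omega
        have hi' : i ≠ i + 1 + 1 := by omega
        simp only [next, if_true, Bool.false_eq_true, if_false, hi, Nat.add_sub_cancel, hi']
        split_ifs with h h' h'
        · refine le_of_eq ?_
          push_cast
          field_simp
          ring
        · exact absurd rfl h'
        · omega
        · obtain rfl : i + 1 = J := le_antisymm hj (not_lt.1 h)
          refine (add_le_add le_rfl hδ).trans (le_of_eq ?_)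
          push_cast
          field_simp
          ring }

end MarketAdversary

/-! ### Deterministic algorithms with small inventories -/

/-- A fractional solution with any positive caps gets the `m`-th part of the profit of an integral
one that holds at most `m` units of each type. -/
theorem intOpt_le_mul_fracOpt {n : ℕ} (ε : ℝ) {w : Fin n → ℕ} (hw : ∀ j, 1 ≤ w j) {m : ℕ}
    (hm : 1 ≤ m) (σ : Instance n) : intOpt ε (fun _ => m) σ ≤ m * fracOpt ε w σ := by
  have hm' : (1 : ℝ) ≤ m := by exact_mod_cast hm
  have hm0 : (0 : ℝ) < m := by linarith
  refine csSup_le ⟨_, _, _, isFeasible_zero _ σ, fun _ => Or.inl rfl,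
    fun _ _ => ⟨0, by simp⟩, rfl⟩ ?_
  rintro p ⟨x, r, hf, -, -, rfl⟩
  have hg : IsFeasible w σ (fun t => x t / m) (fun t i => r t i / m) := by
    refine ⟨fun t => div_nonneg (hf.x_nonneg t) hm0.le,
      fun t => (div_le_one hm0).2 ((hf.x_le_one t).trans hm'),
      fun t i => div_nonneg (hf.r_nonneg t i) hm0.le, fun t i => ?_, fun t ht i => ?_,
      fun t ht i => ?_⟩
    · have h1 : (1 : ℝ) ≤ w i := by exact_mod_cast hw i
      exact ((div_le_one hm0).2 (hf.r_le t i)).trans h1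
    · have := div_le_div_of_nonneg_right (hf.sell t ht i) hm0.le
      rwa [sub_div, mul_div_assoc] at this
    · have := div_le_div_of_nonneg_right (hf.buy t ht i) hm0.le
      rwa [add_div, mul_div_assoc] at this
  have key := mul_le_mul_of_nonneg_left (le_fracOpt ε w σ _ _ hg) hm0.le
  refine le_trans (le_of_eq ?_) key
  unfold offlineProfit
  rw [Finset.mul_sum]
  refine Finset.sum_congr rfl fun t _ => ?_
  field_simp

theorem hasUnboundedRatio_fracOpt {n : ℕ} {ε : ℝ} {w : Fin n → ℕ} (hw : ∀ j, 1 ≤ w j) {m : ℕ}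
    (hm : 1 ≤ m) {K : Set (Instance n)} {alg : Instance n → ℝ}
    (h : HasUnboundedRatio K (intOpt ε fun _ => m) alg) :
    HasUnboundedRatio K (fracOpt ε w) alg := by
  have hm' : (0 : ℝ) < m := by exact_mod_cast hm
  rintro ρ hρ ⟨C, hC⟩
  refine h (m * ρ) (by positivity) ⟨m * C, fun σ hσ => ?_⟩
  have h1 := intOpt_le_mul_fracOpt ε hw hm σ
  have h2 := mul_le_mul_of_nonneg_left (hC σ hσ) hm'.le
  linarith

/-- Values from `(0, v]` with sum at least `1` have a subfamily with sum in `[1, v]`. -/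
theorem exists_subset_sum_mem_Icc {ι : Type*} (I : Finset ι) (f : ι → ℝ) {v : ℝ}
    (hf : ∀ i, f i ≤ v) (hsum : 1 ≤ ∑ i ∈ I, f i) (hI : I.card = 1 ∨ 2 ≤ v) :
    ∃ B ⊆ I, 1 ≤ ∑ i ∈ B, f i ∧ ∑ i ∈ B, f i ≤ v := by
  classical
  by_cases hbig : ∃ i ∈ I, 1 ≤ f i
  · obtain ⟨i, hi, h1⟩ := hbig
    exact ⟨{i}, by simpa using hi, by simpa using h1, by simpa using hf i⟩
  push Not at hbig
  rcases hI with hI | hv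
  · obtain ⟨i, rfl⟩ := Finset.card_eq_one.1 hI
    have := hbig i (by simp)
    simp at hsum
    linarith
  · induction I using Finset.induction_on with
    | empty => simp at hsum; linarith
    | insert a s ha ih =>
      by_cases h1 : 1 ≤ ∑ i ∈ s, f i
      · obtain ⟨B, hB, h⟩ := ih h1 fun i hi => hbig i (by simp [hi])
        exact ⟨B, hB.trans (Finset.subset_insert _ _), h⟩
      · refine ⟨insert a s, subset_rfl, hsum, ?_⟩
        rw [Finset.sum_insert ha]
        have := hbig a (by simp)
        linarith

/-- The bundle with `m` units of each type in `B`. -/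
def blockBundle {n : ℕ} (m : ℕ) (B : Finset (Fin n)) (i : Fin n) : ℕ := if i ∈ B then m else 0

theorem sum_blockBundle {n : ℕ} (m : ℕ) (B : Finset (Fin n)) :
    ∑ i, blockBundle m B i = m * B.card := by
  simp [blockBundle, mul_comm]

/-- The price that the adversary sets for `m` units of a type of which the algorithm holds between
`r * m` and `(r + 1) * m` units: it is high when the algorithm holds little. -/
noncomputable def scarcityPrice (ε v : ℝ) (r : ℕ) : ℝ := v * Real.exp (-(2 * ε * r))

/-- The value of a stock of `r * m` units, where selling any part of it at the scarcity prices on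
the way down is not a gain. -/
noncomputable def stockValue (ε v : ℝ) (r : ℕ) : ℝ :=
  ∑ j ∈ Finset.range r, scarcityPrice ε v (j + 1)

theorem scarcityPrice_nonneg {ε v : ℝ} (hv : 0 ≤ v) (r : ℕ) : 0 ≤ scarcityPrice ε v r :=
  mul_nonneg hv (Real.exp_pos _).le

theorem scarcityPrice_antitone {ε v : ℝ} (hε : 0 ≤ ε) (hv : 0 ≤ v) :
    Antitone (scarcityPrice ε v) := by
  intro r s hrs
  have : (r : ℝ) ≤ s := by exact_mod_cast hrs
  refine mul_le_mul_of_nonneg_left (Real.exp_le_exp.2 ?_) hv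
  nlinarith

theorem scarcityPrice_succ (ε v : ℝ) (r : ℕ) :
    scarcityPrice ε v (r + 1) = scarcityPrice ε v r * Real.exp (-(2 * ε)) := by
  unfold scarcityPrice
  rw [mul_assoc v, ← Real.exp_add]
  congr 2
  push_cast
  ring

theorem stockValue_mono {ε v : ℝ} (hv : 0 ≤ v) : Monotone (stockValue ε v) := by
  intro r s hrs
  exact Finset.sum_le_sum_of_subset_of_nonneg (Finset.range_mono hrs)
    fun _ _ _ => scarcityPrice_nonneg hv _

theorem stockValue_succ (ε v : ℝ) (r : ℕ) :
    stockValue ε v (r + 1) = stockValue ε v r + scarcityPrice ε v (r + 1) :=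
  Finset.sum_range_succ _ _

namespace OnlineAlg

variable {n : ℕ} {w : Fin n → ℕ}

/-- Money plus the value of the stock of the types in `I`, counted in whole blocks of `m` units. -/
noncomputable def blockWealth (A : OnlineAlg w) (ε v : ℝ) (m : ℕ) (I : Finset (Fin n))
    (h : Instance n) : ℝ :=
  A.profit h + ∑ i ∈ I, stockValue ε v (A.inv h i / m)

theorem blockWealth_reject (A : OnlineAlg w) {ε v : ℝ} (hv : 0 ≤ v) (m : ℕ) (I : Finset (Fin n))
    (h : Instance n) (a : Agent n) (ha : A.accept h a = false) :
    A.blockWealth ε v m I (h ++ [a]) ≤ A.blockWealth ε v m I h := by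
  have h1 : A.profit (h ++ [a]) = A.profit h := by simp [profit_concat, gain, ha]
  unfold blockWealth
  rw [h1]
  gcongr with i hi
  exact stockValue_mono hv (Nat.div_le_div_right (A.inv_reject h a ha i))

theorem blockWealth_buy (A : OnlineAlg w) {ε v : ℝ} (hv : 0 ≤ v) {m : ℕ} (hm : 0 < m)
    {I B : Finset (Fin n)} (hB : B ⊆ I) (h : Instance n) (x : ℝ) (hx : 0 ≤ x)
    (ha : A.accept h ⟨false, blockBundle m B, x, hx⟩ = true) :
    A.blockWealth ε v m I (h ++ [⟨false, blockBundle m B, x, hx⟩]) ≤ A.blockWealth ε v m I h - x +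
      ∑ i ∈ B, scarcityPrice ε v (A.inv h i / m + 1) := by
  have h1 : A.profit (h ++ [⟨false, blockBundle m B, x, hx⟩]) = A.profit h - x := by
    simp [profit_concat, gain, ha, sub_eq_add_neg]
  have h2 : ∑ i ∈ B, scarcityPrice ε v (A.inv h i / m + 1) =
      ∑ i ∈ I, if i ∈ B then scarcityPrice ε v (A.inv h i / m + 1) else 0 := by
    rw [← Finset.sum_filter, Finset.filter_mem_eq_inter, Finset.inter_eq_right.2 hB]
  unfold blockWealth
  rw [h1, h2]
  have : ∑ i ∈ I, stockValue ε v (A.inv (h ++ [⟨false, blockBundle m B, x, hx⟩]) i / m) ≤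
      ∑ i ∈ I, (stockValue ε v (A.inv h i / m) +
        if i ∈ B then scarcityPrice ε v (A.inv h i / m + 1) else 0) := by
    refine Finset.sum_le_sum fun i _ => ?_
    have hinv := A.inv_buy h _ ha rfl i
    simp only [blockBundle] at hinv
    split_ifs with hi
    · rw [← stockValue_succ]
      rw [if_pos hi] at hinv
      refine stockValue_mono hv ?_
      rw [← Nat.add_div_right _ hm]
      exact Nat.div_le_div_right hinv
    · rw [if_neg hi] at hinv
      rw [add_zero]
      exact stockValue_mono hv (Nat.div_le_div_right hinv)
  rw [Finset.sum_add_distrib] at this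
  linarith

theorem blockWealth_sell (A : OnlineAlg w) {ε v : ℝ} (hv : 0 ≤ v) {m : ℕ} (hm : 0 < m)
    {I B : Finset (Fin n)} (hB : B ⊆ I) (h : Instance n) (x : ℝ) (hx : 0 ≤ x)
    (ha : A.accept h ⟨true, blockBundle m B, x, hx⟩ = true) :
    A.blockWealth ε v m I (h ++ [⟨true, blockBundle m B, x, hx⟩]) ≤ A.blockWealth ε v m I h + x -
      ∑ i ∈ B, scarcityPrice ε v (A.inv h i / m) := by
  have h1 : A.profit (h ++ [⟨true, blockBundle m B, x, hx⟩]) = A.profit h + x := by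
    simp [profit_concat, gain, ha]
  have h2 : ∑ i ∈ B, scarcityPrice ε v (A.inv h i / m) =
      ∑ i ∈ I, if i ∈ B then scarcityPrice ε v (A.inv h i / m) else 0 := by
    rw [← Finset.sum_filter, Finset.filter_mem_eq_inter, Finset.inter_eq_right.2 hB]
  unfold blockWealth
  rw [h1, h2]
  have : ∑ i ∈ I, (stockValue ε v (A.inv (h ++ [⟨true, blockBundle m B, x, hx⟩]) i / m) +
      if i ∈ B then scarcityPrice ε v (A.inv h i / m) else 0) ≤
      ∑ i ∈ I, stockValue ε v (A.inv h i / m) := by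
    refine Finset.sum_le_sum fun i _ => ?_
    have hinv := A.inv_sell h _ ha rfl i
    simp only [blockBundle] at hinv
    split_ifs with hi
    · rw [if_pos hi] at hinv
      have h3 := Nat.div_le_div_right (c := m) hinv
      rw [Nat.add_div_right _ hm] at h3
      obtain ⟨r, hr⟩ := Nat.exists_eq_add_of_le' ((Nat.succ_pos _).trans_le h3)
      rw [hr] at h3 ⊢
      rw [stockValue_succ]
      gcongr
      exact stockValue_mono hv (Nat.le_of_succ_le_succ h3)
    · rw [if_neg hi] at hinv
      rw [add_zero]
      exact stockValue_mono hv (Nat.div_le_div_right hinv)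
  rw [Finset.sum_add_distrib] at this
  linarith

end OnlineAlg

/-- Buying a block and selling it at once, with a stock of at most `m` units of each type. -/
theorem OfflineRun.buy_sell {n : ℕ} {ε : ℝ} {m : ℕ} {σ : Instance n} {y : ℝ}
    (h : OfflineRun ε (fun _ => m) {0, 1} (Set.range Nat.cast) σ 0 y) (B : Finset (Fin n))
    (p x : ℝ) (hp : 0 ≤ p) (hx : 0 ≤ x) :
    OfflineRun ε (fun _ => m) {0, 1} (Set.range Nat.cast)
      (σ ++ [⟨false, blockBundle m B, p, hp⟩] ++ [⟨true, blockBundle m B, x, hx⟩]) 0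
      (y - (1 + ε) * p + x) := by
  have h1 := h.concat ⟨false, blockBundle m B, p, hp⟩ 1 (fun i => (blockBundle m B i : ℝ))
    (by simp) zero_le_one le_rfl (fun i => ⟨_, rfl⟩) (fun i => Nat.cast_nonneg _)
    (fun i => by
      unfold blockBundle
      split_ifs <;> simp) (by simp) (by simp)
  have h2 := h1.concat ⟨true, blockBundle m B, x, hx⟩ 1 0 (by simp) zero_le_one le_rfl
    (fun i => ⟨0, by simp⟩) (fun i => le_rfl) (fun i => Nat.cast_nonneg _) (by simp) (by simp)
  convert h2 using 1
  simp [Agent.offlineGain]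
  ring

/-- The adversary against small inventories: it offers a bundle slightly below its scarcity price
and, if the algorithm rejects, asks for it at the scarcity price. If the algorithm buys, it loses,
as after the purchase the bundle is sold only at the scarcity prices of the next level. If it
rejects, the offline solution gains, and the algorithm does not. -/
theorem hasUnboundedRatio_intOpt {n : ℕ} {ε : ℝ} (hε : 0 < ε) {w : Fin n → ℕ} {m k : ℕ} {v : ℝ}
    (hm : 1 ≤ m) (hkn : k ≤ n) (hv : 1 ≤ v) (I : Finset (Fin n)) (hI0 : 1 ≤ I.card)
    (hIk : I.card ≤ k) (hI : I.card = 1 ∨ 2 ≤ v)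
    (hw : ∀ i ∈ I, 2 * ε * w i ≤ Real.log (I.card * v) * m) (A : OnlineAlg w) :
    HasUnboundedRatio (multiplicityInstances n m (m * k) v) (intOpt ε fun _ => m) A.profit := by
  rintro ρ hρ ⟨C, hC⟩
  have hv0 : 0 ≤ v := zero_le_one.trans hv
  have hm0 : (0 : ℝ) < m := by exact_mod_cast hm
  have hc0 : (0 : ℝ) < I.card := by exact_mod_cast hI0
  obtain ⟨J, -, hJ⟩ := Finset.exists_subset_card_eq (s := (Finset.univ : Finset (Fin n)))
    (n := k) (by simpa using hkn)
  set K := multiplicityInstances n m (m * k) v with hKdef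
  set h₀ : Instance n := seed (blockBundle m J) v hv0 with hh₀
  have hbb : ∀ (B : Finset (Fin n)) j, blockBundle m B j = 0 ∨ blockBundle m B j = m := by
    intro B j
    unfold blockBundle
    split_ifs <;> simp
  have hseed : h₀ ∈ K := by
    constructor
    · have := hasParams_seed (blockBundle m J) hv
      rwa [sum_blockBundle, hJ] at this
    · intro a ha
      simp only [hh₀, seed, List.mem_cons, List.not_mem_nil, or_false] at ha
      rcases ha with rfl | rfl <;>
        exact ⟨by simp only [Agent.size, sum_blockBundle, hJ, le_refl], hbb J⟩
  -- The two gains per round: `θ` for a purchase of the algorithm, `η` for the offline solution.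
  set β : ℝ := 1 / (1 + 3 / 2 * ε) with hβ
  set θ : ℝ := β - Real.exp (-(2 * ε)) with hθ
  set η : ℝ := 1 - (1 + ε) * β with hη
  have hβ0 : 0 < β := by positivity
  have hθ0 : 0 < θ := by
    rw [hθ, hβ, sub_pos, Real.exp_neg, ← one_div]
    refine one_div_lt_one_div_of_lt (by positivity) ?_
    linarith [Real.add_one_le_exp (2 * ε)]
  have hη0 : 0 < η := by
    rw [hη, hβ, sub_pos, mul_one_div, div_lt_one (by positivity)]
    linarith
  set δ : ℝ := min η (ρ * θ) with hδ
  have hδ0 : 0 < δ := lt_min hη0 (mul_pos hρ hθ0)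
  set P : Instance n → ℝ := A.blockWealth ε v m I with hP
  have hround : ∀ N : ℕ, ∃ σ ∈ K, ∃ y,
      OfflineRun ε (fun _ => m) {0, 1} (Set.range Nat.cast) σ 0 y ∧
      N * δ - ρ * P h₀ ≤ y - ρ * P σ := by
    intro N
    induction N with
    | zero =>
      refine ⟨h₀, hseed, 0, ?_, by simp⟩
      simpa using OfflineRun.nil.append_idle (ε := ε) (cap := fun _ => m) (X := {0, 1})
        (S := Set.range Nat.cast) (by simp) (Set.mem_range.2 ⟨0, Nat.cast_zero⟩) h₀
    | succ N ih =>
      obtain ⟨σ, ⟨hσp, hσb⟩, y, hy, hle⟩ := ih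
      set f : Fin n → ℝ := fun i => scarcityPrice ε v (A.inv σ i / m) with hf
      have hf0 : ∀ i, 0 ≤ f i := fun i => scarcityPrice_nonneg hv0 _
      have hfv : ∀ i, f i ≤ v := fun i => by
        refine mul_le_of_le_one_right hv0 (Real.exp_le_one_iff.2 ?_)
        have : 0 ≤ 2 * ε * ((A.inv σ i / m : ℕ) : ℝ) := by positivity
        linarith
      have hflow : ∀ i ∈ I, 1 / (I.card : ℝ) ≤ f i := by
        intro i hi
        have h1 : ((A.inv σ i / m : ℕ) : ℝ) ≤ w i / m :=
          Nat.cast_div_le.trans (by gcongr; exact A.inv_le σ i)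
        have h2 : 2 * ε * ((A.inv σ i / m : ℕ) : ℝ) ≤ Real.log (I.card * v) := by
          have h3 : 2 * ε * (w i / m) ≤ Real.log (I.card * v) := by
            rw [← mul_div_assoc, div_le_iff₀ hm0]
            exact hw i hi
          exact (mul_le_mul_of_nonneg_left h1 (by positivity)).trans h3
        have h4 : Real.exp (-Real.log (I.card * v)) ≤
            Real.exp (-(2 * ε * ((A.inv σ i / m : ℕ) : ℝ))) :=
          Real.exp_le_exp.2 (neg_le_neg h2)
        rw [Real.exp_neg, Real.exp_log (by positivity)] at h4
        refine le_trans (le_of_eq ?_) (mul_le_mul_of_nonneg_left h4 hv0)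
        field_simp
      have hsum : 1 ≤ ∑ i ∈ I, f i := by
        have := Finset.card_nsmul_le_sum I f _ hflow
        rwa [nsmul_eq_mul, mul_one_div_cancel hc0.ne'] at this
      obtain ⟨B, hBI, hB1, hBv⟩ := exists_subset_sum_mem_Icc I f hfv hsum hI
      set x : ℝ := ∑ i ∈ B, f i with hx
      have hx0 : 0 ≤ x := zero_le_one.trans hB1
      have hp0 : 0 ≤ x * β := by positivity
      have hBk : m * B.card ≤ m * k :=
        Nat.mul_le_mul_left m ((Finset.card_le_card hBI).trans hIk)
      set a₁ : Agent n := ⟨false, blockBundle m B, x * β, hp0⟩ with ha₁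
      set a₂ : Agent n := ⟨true, blockBundle m B, x, hx0⟩ with ha₂
      have hgood : ∀ a ∈ [a₁, a₂], (a.size ≤ m * k ∧
          (a.isCustomer = true → a.value = 0 ∨ 1 ≤ a.value ∧ a.value ≤ v)) ∧
          ∀ j, a.bundle j = 0 ∨ a.bundle j = m := by
        intro a ha
        simp only [List.mem_cons, List.not_mem_nil, or_false] at ha
        rcases ha with rfl | rfl
        · exact ⟨⟨by simpa only [Agent.size, ha₁, sum_blockBundle], by simp [ha₁]⟩, hbb B⟩
        · exact ⟨⟨by simpa only [Agent.size, ha₂, sum_blockBundle],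
            fun _ => Or.inr ⟨hB1, hBv⟩⟩, hbb B⟩
      have hmem : ∀ l ⊆ [a₁, a₂], σ ++ l ∈ K := fun l hl =>
        ⟨hσp.append hv0 fun a ha => (hgood a (hl ha)).1, fun a ha => by
          rcases List.mem_append.1 ha with ha | ha
          · exact hσb a ha
          · exact ⟨(hgood a (hl ha)).1.1, (hgood a (hl ha)).2⟩⟩
      cases hacc : A.accept σ a₁ with
      | true =>
        refine ⟨σ ++ [a₁], hmem _ (by simp), y, hy.append_idle (by simp)
          (Set.mem_range.2 ⟨0, Nat.cast_zero⟩) _, ?_⟩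
        have hbuy := A.blockWealth_buy (ε := ε) hv0 hm hBI σ (x * β) hp0 hacc
        simp only [scarcityPrice_succ, ← Finset.sum_mul] at hbuy
        have h1 : P (σ ++ [a₁]) ≤ P σ - θ := by
          have : θ ≤ x * θ := le_mul_of_one_le_left hθ0.le hB1
          rw [hθ] at this ⊢
          rw [mul_sub] at this
          linarith
        have h2 := mul_le_mul_of_nonneg_left h1 hρ.le
        have h3 : δ ≤ ρ * θ := min_le_right _ _
        push_cast
        linarith
      | false =>
        refine ⟨σ ++ [a₁] ++ [a₂], ?_, _, hy.buy_sell B (x * β) x hp0 hx0, ?_⟩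
        · rw [List.append_assoc]
          exact hmem _ (by simp)
        have h1 := A.blockWealth_reject (ε := ε) hv0 m I σ a₁ hacc
        have h2 : P (σ ++ [a₁] ++ [a₂]) ≤ P (σ ++ [a₁]) := by
          cases hacc₂ : A.accept (σ ++ [a₁]) a₂ with
          | false => exact A.blockWealth_reject hv0 m I _ a₂ hacc₂
          | true =>
            refine (A.blockWealth_sell (ε := ε) hv0 hm hBI _ x hx0 hacc₂).trans ?_
            -- Stock discarded meanwhile only makes the scarcity prices rise.
            have : x ≤ ∑ i ∈ B, scarcityPrice ε v (A.inv (σ ++ [a₁]) i / m) :=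
              Finset.sum_le_sum fun i _ => scarcityPrice_antitone hε.le hv0
                (Nat.div_le_div_right (A.inv_reject σ a₁ hacc i))
            simp only [hP]
            linarith
        have h3 := mul_le_mul_of_nonneg_left (h2.trans h1) hρ.le
        have h4 : δ ≤ η := min_le_left _ _
        have h5 : η ≤ x * η := le_mul_of_one_le_left hη0.le hB1
        have h6 : x * η = x - (1 + ε) * (x * β) := by rw [hη]; ring
        push_cast
        linarith
  obtain ⟨N, hN⟩ := exists_nat_gt ((C + ρ * P h₀) / δ)
  rw [div_lt_iff₀ hδ0] at hN
  obtain ⟨σ, hσ, y, hy, hle⟩ := hround N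
  have h1 := hy.le_intOpt
  have h2 := hC σ hσ
  have h3 : A.profit σ ≤ P σ :=
    le_add_of_nonneg_right (Finset.sum_nonneg fun i _ =>
      Finset.sum_nonneg fun j _ => scarcityPrice_nonneg hv0 _)
  have h4 := mul_le_mul_of_nonneg_left h3 hρ.le
  linarith

/-! ### The bounds -/

/-- The walk with the largest possible number of levels, or free supply if there is no level above
the lowest price. -/
theorem exists_marketAdversary {ε ρ : ℝ} (hε : 0 < ε) {D d : ℕ} (hD : 1 ≤ D) (hDd : D ≤ d)
    {v : ℝ} (hv : 1 ≤ v) (hDv : D = 1 ∨ 2 ≤ v) (hρ : ρ < 1 / 8 / ε * Real.log (D * v)) :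
    Nonempty (MarketAdversary ε ρ d v) := by
  have hD0 : (1 : ℝ) ≤ D := by exact_mod_cast hD
  have hDv0 : 0 < D * v := by positivity
  have hu : 1 < 1 + 2 * ε := by linarith
  have hlogu : 0 < Real.log (1 + 2 * ε) := Real.log_pos hu
  have hlogu' : Real.log (1 + 2 * ε) ≤ 2 * ε := by
    have := Real.log_le_sub_one_of_pos (zero_lt_one.trans hu)
    linarith
  have hlog : 0 ≤ Real.log (D * v) := Real.log_nonneg (one_le_mul_of_one_le_of_one_le hD0 hv)
  have hρ' : ρ * (8 * ε) < Real.log (D * v) := by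
    rwa [div_div, div_mul_eq_mul_div, one_mul, lt_div_iff₀ (by positivity)] at hρ
  rcases lt_or_ge (Real.log (D * v)) (Real.log (1 + 2 * ε)) with h | h
  · refine ⟨MarketAdversary.freeSupply ε ?_ (hD.trans hDd) hv⟩
    nlinarith
  · set J := ⌊Real.log (D * v) / Real.log (1 + 2 * ε)⌋₊ with hJdef
    have hJ : 1 ≤ J := Nat.le_floor (by rw [Nat.cast_one]; exact (one_le_div hlogu).2 h)
    refine ⟨MarketAdversary.reflectedWalk hε hD hDd hDv hJ ?_ ?_⟩
    · rw [← Real.log_le_log_iff (by positivity) hDv0, Real.log_pow, ← le_div_iff₀ hlogu]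
      exact Nat.floor_le (by positivity)
    · have h1 := Nat.lt_floor_add_one (Real.log (D * v) / Real.log (1 + 2 * ε))
      rw [← hJdef, div_lt_iff₀ hlogu] at h1
      have hJ' : (1 : ℝ) ≤ J := by exact_mod_cast hJ
      have h2 : (J + 1) * Real.log (1 + 2 * ε) ≤ (2 * J) * (2 * ε) := by
        gcongr
        linarith
      rw [lt_div_iff₀ two_pos]
      refine lt_of_mul_lt_mul_right (a := 4 * ε) ?_ (by positivity)
      linarith

/-- The price range `[1 / D, v]` is available with `D = 1`, and with `D = d` if `2 ≤ v`. -/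
theorem log_le_of_no_adversary {ε ρ : ℝ} (hε : 0 < ε) {d : ℕ} {v : ℝ} (hd : 1 ≤ d) (hv : 1 ≤ v)
    (h : ¬ Nonempty (MarketAdversary ε ρ d v)) :
    1 / 8 / ε * Real.log v ≤ ρ ∧ (2 ≤ v → 1 / 8 / ε * Real.log (d * v) ≤ ρ) := by
  constructor
  · by_contra! hρ
    exact h (exists_marketAdversary (D := 1) hε le_rfl hd hv (Or.inl rfl) (by simpa using hρ))
  · intro hv2
    by_contra! hρ
    exact h (exists_marketAdversary (D := d) hε hd le_rfl hv (Or.inr hv2) hρ)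

theorem hasUnboundedRatio_of_small_inventory {n : ℕ} {ε : ℝ} (hε : 0 < ε) {w : Fin n → ℕ}
    (hw1 : ∀ j, 1 ≤ w j) {m k : ℕ} {v : ℝ} (hm : 1 ≤ m) (hkn : k ≤ n) (hv : 1 ≤ v)
    (I : Finset (Fin n)) (hI0 : 1 ≤ I.card) (hIk : I.card ≤ k) (hI : I.card = 1 ∨ 2 ≤ v)
    (hw : ∀ i ∈ I, 2 * ε * w i ≤ Real.log (I.card * v) * m) (A : OnlineAlg w) :
    HasUnboundedRatio (multiplicityInstances n m (m * k) v) (fracOpt ε w) A.profit ∧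
      HasUnboundedRatio (multiplicityInstances n m (m * k) v) (intOpt ε fun _ => m) A.profit :=
  have h := hasUnboundedRatio_intOpt hε hm hkn hv I hI0 hIk hI hw A
  ⟨hasUnboundedRatio_fracOpt hw1 hm h, h⟩

end OnlineTrading

theorem theorem4p1 :
    -- lower bound for deterministic and randomized algorithms, with a single item type
    (∃ c : ℝ, 0 < c ∧ ∀ (ε : ℝ), 0 < ε → ε ≤ 1 →
      ∀ (n : ℕ) (w : Fin n → ℕ), (∀ j, 1 ≤ w j) →
      ∀ (i : Fin n) (d : ℕ) (v : ℝ), 1 ≤ d → 1 ≤ v →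
        (∀ (A : OnlineAlg w) (ρ : ℝ), 0 < ρ →
          IsCompetitive (singleTypeInstances i d v) (fracOpt ε w) A.profit ρ →
            c / ε * Real.log v ≤ ρ ∧ (2 ≤ v → c / ε * Real.log (d * v) ≤ ρ)) ∧
        (∀ (Ω : Type*) [MeasurableSpace Ω] (μ : Measure Ω) [IsProbabilityMeasure μ]
          (R : RandomizedAlg w Ω) (ρ : ℝ), 0 < ρ →
          IsCompetitive (singleTypeInstances i d v) (fracOpt ε w) (R.expectedProfit μ) ρ →
            c / ε * Real.log v ≤ ρ ∧ (2 ≤ v → c / ε * Real.log (d * v) ≤ ρ))) ∧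
    -- without augmentation of the supplier values no algorithm has a finite ratio
    (∀ (n : ℕ) (w : Fin n → ℕ), (∀ j, 1 ≤ w j) →
      ∀ (i : Fin n) (d : ℕ) (v : ℝ), 1 ≤ d → 1 ≤ v →
        (∀ A : OnlineAlg w,
          HasUnboundedRatio (singleTypeInstances i d v) (fracOpt 0 w) A.profit) ∧
        (∀ (Ω : Type*) [MeasurableSpace Ω] (μ : Measure Ω) [IsProbabilityMeasure μ]
          (R : RandomizedAlg w Ω),
          HasUnboundedRatio (singleTypeInstances i d v) (fracOpt 0 w) (R.expectedProfit μ))) ∧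
    -- small inventory: bundles with `m` units of each of at most `k` types, so `d = m * k`
    (∃ c : ℝ, 0 < c ∧ ∀ (ε : ℝ), 0 < ε → ε ≤ 1 →
      ∀ (n : ℕ) (w : Fin n → ℕ), (∀ j, 1 ≤ w j) →
      ∀ (m k : ℕ) (v : ℝ), 1 ≤ m → m ≤ k → 1 ≤ v → (m * k = 1 ∨ 2 ≤ v) →
      ∀ I : Finset (Fin n), k ≤ I.card →
        (∀ i ∈ I, (w i : ℝ) < c / ε * Real.log ((m * k : ℕ) * v) * m) →
        ∀ A : OnlineAlg w,
          HasUnboundedRatio (multiplicityInstances n m (m * k) v) (fracOpt ε w) A.profit ∧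
          HasUnboundedRatio (multiplicityInstances n m (m * k) v) (intOpt ε fun _ => m)
            A.profit) ∧
    -- one cap is too small compared to `v`
    (∀ (ε : ℝ), 0 < ε → ε ≤ 1 →
      ∀ (n : ℕ) (w : Fin n → ℕ), (∀ j, 1 ≤ w j) →
      ∀ (m k : ℕ) (v : ℝ), 1 ≤ m → 1 ≤ k → k ≤ n → 1 ≤ v →
      ∀ i : Fin n, (w i : ℝ) < 1 / (4 * ε) * Real.log v * m →
        ∀ A : OnlineAlg w,
          HasUnboundedRatio (multiplicityInstances n m (m * k) v) (fracOpt ε w) A.profit ∧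
          HasUnboundedRatio (multiplicityInstances n m (m * k) v) (intOpt ε fun _ => m)
            A.profit) ∧
    -- `k` caps are too small compared to `k` (which is `d` when `m = 1`)
    (∀ (ε : ℝ), 0 < ε → ε ≤ 1 →
      ∀ (n : ℕ) (w : Fin n → ℕ), (∀ j, 1 ≤ w j) →
      ∀ (m k : ℕ) (v : ℝ), 1 ≤ m → 1 ≤ k → 2 ≤ v →
      ∀ I : Finset (Fin n), k ≤ I.card →
        (∀ i ∈ I, (w i : ℝ) < 1 / (8 * ε) * Real.log k * m) →
        ∀ A : OnlineAlg w,
          HasUnboundedRatio (multiplicityInstances n m (m * k) v) (fracOpt ε w) A.profit ∧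
          HasUnboundedRatio (multiplicityInstances n m (m * k) v) (intOpt ε fun _ => m)
            A.profit) := by
  refine ⟨⟨1 / 8, by norm_num, fun ε hε _ n w hw i d v hd hv => ⟨fun A ρ hρ hA => ?_,
      fun Ω _ μ _ R ρ hρ hR => ?_⟩⟩, fun n w hw i d v hd hv => ⟨fun A ρ hρ => ?_,
      fun Ω _ μ _ R ρ hρ => ?_⟩, ⟨1 / 4, by norm_num, ?_⟩, ?_, ?_⟩
  · exact log_le_of_no_adversary hε hd hv fun ⟨M⟩ =>
      M.not_isCompetitive_deterministic i hρ.le hd hv (hw i) A hA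
  · exact log_le_of_no_adversary hε hd hv fun ⟨M⟩ =>
      M.not_isCompetitive i hρ.le hd hv (hw i) μ R hR
  · obtain ⟨J, hJ⟩ := exists_nat_ge (2 * ρ)
    exact (MarketAdversary.doublingGap hJ hd hv).not_isCompetitive_deterministic i hρ.le hd hv
      (hw i) A
  · obtain ⟨J, hJ⟩ := exists_nat_ge (2 * ρ)
    exact (MarketAdversary.doublingGap hJ hd hv).not_isCompetitive i hρ.le hd hv (hw i) μ R
  · intro ε hε _ n w hw m k v hm hmk hv hmv I hI hwI A
    obtain ⟨I', hI', rfl⟩ := Finset.exists_subset_card_eq hI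
    have hk : 1 ≤ I'.card := hm.trans hmk
    refine hasUnboundedRatio_of_small_inventory hε hw hm (by simpa using I'.card_le_univ) hv I' hk
      le_rfl (hmv.imp_left fun h => Nat.eq_one_of_mul_eq_one_left h) (fun i hi => ?_) A
    -- As `m ≤ k`, the logarithm of `m * k * v` is at most twice that of `k * v`.
    have hk1 : (1 : ℝ) ≤ I'.card := by exact_mod_cast hk
    have hm0 : (0 : ℝ) < m := by exact_mod_cast hm
    have hmk' : (m : ℝ) ≤ I'.card := by exact_mod_cast hmk
    have hlog : Real.log ((m * I'.card : ℕ) * v) ≤ 2 * Real.log (I'.card * v) := by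
      rw [← Nat.cast_ofNat, ← Real.log_pow]
      refine Real.log_le_log (by positivity) ?_
      push_cast
      nlinarith [mul_le_mul hmk' hv zero_le_one (by positivity),
        mul_nonneg (by positivity : (0 : ℝ) ≤ I'.card * v)
          (by nlinarith : (0 : ℝ) ≤ I'.card * v - m)]
    have h := hwI i (hI' hi)
    rw [div_div, div_mul_eq_mul_div, div_mul_eq_mul_div, one_mul, lt_div_iff₀ (by positivity)] at h
    have := mul_le_mul_of_nonneg_right hlog hm0.le
    linarith
  · intro ε hε _ n w hw m k v hm hk hkn hv i hwi A
    refine hasUnboundedRatio_of_small_inventory hε hw hm hkn hv {i} (by simp) (by simpa using hk)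
      (by simp) (fun j hj => ?_) A
    obtain rfl := Finset.mem_singleton.1 hj
    rw [div_mul_eq_mul_div, div_mul_eq_mul_div, one_mul, lt_div_iff₀ (by positivity)] at hwi
    have : 0 ≤ ε * w j := by positivity
    simp only [Finset.card_singleton, Nat.cast_one, one_mul]
    linarith
  · intro ε hε _ n w hw m k v hm hk hv I hI hwI A
    obtain ⟨I', hI', rfl⟩ := Finset.exists_subset_card_eq hI
    have hv1 : 1 ≤ v := one_le_two.trans hv
    refine hasUnboundedRatio_of_small_inventory hε hw hm (by simpa using I'.card_le_univ) hv1 I' hk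
      le_rfl (Or.inr hv) (fun i hi => ?_) A
    have hk0 : (0 : ℝ) < I'.card := by exact_mod_cast hk
    have hm0 : (0 : ℝ) < m := by exact_mod_cast hm
    have hlog : Real.log I'.card ≤ Real.log (I'.card * v) :=
      Real.log_le_log hk0 (le_mul_of_one_le_right hk0.le hv1)
    have h := hwI i (hI' hi)
    rw [div_mul_eq_mul_div, div_mul_eq_mul_div, one_mul, lt_div_iff₀ (by positivity)] at h
    have := mul_le_mul_of_nonneg_right hlog hm0.le
    have : 0 ≤ ε * w i := by positivity
    linarith
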